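/- Theorem. A graph is called $(P_3+K_1)$-free if it does not contain, as an induced subgraph, the disjoint union of a path on three vertices and a single vertex. A minimum modulator to a $(P_3+K_1)$-free graph in a graph $G$ is a set $M\subseteq V(G)$ of minimum size such that $G-M$ is $(P_3+K_1)$-free. There is a polynomial-time algorithm that, given any finite simple graph $G$ (and no further information), computes a proper colouring of $G$ that uses, for every minimum modulator $M$ to a $(P_3+K_1)$-free graph in $G$, at most $\chi(G-M)+|M|$ colours, where $\chi$ denotes the chromatic number. Here an algorithm is a program of a random access machine that has the elementary operations of addition, subtraction, indirect reading and writing of memory, and tests for zero; it receives the number $n$ of vertices and the adjacency matrix of $G$ as its input and halts after at most $p(n)$ steps, for a fixed polynomial $p$. -/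

import Mathlib

/-! ## Random access machines with a step count -/

namespace Ram

/-- The memory of a random access machine: registers and arrays of natural numbers. A program
mentions only finitely many registers and arrays, but an array has unboundedly many cells, which
are addressed by the contents of registers. -/
structure State where
  reg : ℕ → ℕ
  arr : ℕ → ℕ → ℕ

/-- The state `s` with `v` written to register `x`. -/
def State.setReg (s : State) (x v : ℕ) : State :=
  { s with reg := Function.update s.reg x v }

/-- The state `s` with `v` written to cell `i` of array `a`. -/
def State.setArr (s : State) (a i v : ℕ) : State :=
  { s with arr := Function.update s.arr a (Function.update (s.arr a) i v) }

/-- Programs of a random access machine whose only arithmetic operations are addition and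
subtraction (so that unit cost is a realistic measure of time). -/
inductive Program : Type
  /-- `x := c` -/
  | const (x c : ℕ)
  /-- `x := y + z` -/
  | add (x y z : ℕ)
  /-- `x := y - z`, truncated at zero -/
  | sub (x y z : ℕ)
  /-- `x := a[i]`, where the index is the content of register `i` -/
  | load (x a i : ℕ)
  /-- `a[i] := x`, where the index is the content of register `i` -/
  | store (a i x : ℕ)
  /-- first `P`, then `Q` -/
  | seq (P Q : Program)
  /-- `P` if register `x` is nonzero, otherwise `Q` -/
  | ite (x : ℕ) (P Q : Program)
  /-- repeat `P` as long as register `x` is nonzero -/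
  | loop (x : ℕ) (P : Program)

/-- `Exec P s t s'`: started in state `s`, the program `P` halts after exactly `t` steps, in
state `s'`. Every instruction and every test of a register counts as one step. -/
inductive Exec : Program → State → ℕ → State → Prop
  | const (x c : ℕ) (s : State) : Exec (.const x c) s 1 (s.setReg x c)
  | add (x y z : ℕ) (s : State) : Exec (.add x y z) s 1 (s.setReg x (s.reg y + s.reg z))
  | sub (x y z : ℕ) (s : State) : Exec (.sub x y z) s 1 (s.setReg x (s.reg y - s.reg z))
  | load (x a i : ℕ) (s : State) : Exec (.load x a i) s 1 (s.setReg x (s.arr a (s.reg i)))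
  | store (a i x : ℕ) (s : State) : Exec (.store a i x) s 1 (s.setArr a (s.reg i) (s.reg x))
  | seq {P Q : Program} {s s₁ s₂ : State} {t₁ t₂ : ℕ} (hP : Exec P s t₁ s₁)
      (hQ : Exec Q s₁ t₂ s₂) : Exec (.seq P Q) s (t₁ + t₂) s₂
  | ite_true {x : ℕ} {P Q : Program} {s s₁ : State} {t : ℕ} (hx : s.reg x ≠ 0)
      (hP : Exec P s t s₁) : Exec (.ite x P Q) s (t + 1) s₁
  | ite_false {x : ℕ} {P Q : Program} {s s₁ : State} {t : ℕ} (hx : s.reg x = 0)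
      (hQ : Exec Q s t s₁) : Exec (.ite x P Q) s (t + 1) s₁
  | loop_done {x : ℕ} {P : Program} {s : State} (hx : s.reg x = 0) : Exec (.loop x P) s 1 s
  | loop_step {x : ℕ} {P : Program} {s s₁ s₂ : State} {t₁ t₂ : ℕ} (hx : s.reg x ≠ 0)
      (hP : Exec P s t₁ s₁) (hL : Exec (.loop x P) s₁ t₂ s₂) :
      Exec (.loop x P) s (t₁ + t₂ + 1) s₂

/-- The machine is deterministic: the running time and the final state are determined by the
program and the initial state. -/
theorem Exec.deterministic {P : Program} {s s₁ s₂ : State} {t₁ t₂ : ℕ} (h₁ : Exec P s t₁ s₁)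
    (h₂ : Exec P s t₂ s₂) : t₁ = t₂ ∧ s₁ = s₂ := by
  induction h₁ generalizing t₂ s₂ with
  | const | add | sub | load | store => cases h₂; exact ⟨rfl, rfl⟩
  | seq _ _ ihP ihQ =>
    cases h₂ with
    | seq hP hQ =>
      obtain ⟨rfl, rfl⟩ := ihP hP
      obtain ⟨rfl, rfl⟩ := ihQ hQ
      exact ⟨rfl, rfl⟩
  | ite_true hx _ ih =>
    cases h₂ with
    | ite_true _ h => obtain ⟨rfl, rfl⟩ := ih h; exact ⟨rfl, rfl⟩
    | ite_false h _ => exact absurd h hx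
  | ite_false hx _ ih =>
    cases h₂ with
    | ite_true h _ => exact absurd hx h
    | ite_false _ h => obtain ⟨rfl, rfl⟩ := ih h; exact ⟨rfl, rfl⟩
  | loop_done hx =>
    cases h₂ with
    | loop_done _ => exact ⟨rfl, rfl⟩
    | loop_step h _ _ => exact absurd hx h
  | loop_step hx _ _ ihP ihL =>
    cases h₂ with
    | loop_done h => exact absurd h hx
    | loop_step _ hP hL =>
      obtain ⟨rfl, rfl⟩ := ihP hP
      obtain ⟨rfl, rfl⟩ := ihL hL
      exact ⟨rfl, rfl⟩

open Classical in
/-- The initial state on input `G`: register `0` holds the number `n` of vertices, array `0` holds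
the adjacency matrix of `G` row by row, and everything else is `0`. -/
noncomputable def graphInput {n : ℕ} (G : SimpleGraph (Fin n)) : State where
  reg x := if x = 0 then n else 0
  arr a k := if a = 0 ∧ ∃ u v : Fin n, k = u * n + v ∧ G.Adj u v then 1 else 0

/-- The colour that is assigned to the vertex `v` in a final state: the content of cell `v` of
array `1`. -/
def State.colour {n : ℕ} (s : State) (v : Fin n) : ℕ := s.arr 1 v

end Ram

/-! ## Modulators and `(P₃ + K₁)`-free graphs -/

open SimpleGraph in
/-- `G` does not contain the disjoint union of a path on three vertices and a single vertex as an
induced subgraph. -/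
def P3K1Free {V : Type} (G : SimpleGraph V) : Prop :=
  ¬ (pathGraph 3 ⊕g completeGraph (Fin 1)).IsIndContained G

/-- `M` is a modulator to the graph class `C` in `G`: the graph `G - M` belongs to `C`. -/
def IsModulator (C : ∀ ⦃V : Type⦄, SimpleGraph V → Prop) {V : Type} (G : SimpleGraph V)
    (M : Finset V) : Prop :=
  C (G.induce (M : Set V)ᶜ)

/-- `M` is a modulator to the graph class `C` in `G` of minimum size. -/
def IsMinimumModulator (C : ∀ ⦃V : Type⦄, SimpleGraph V → Prop) {V : Type} (G : SimpleGraph V)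
    (M : Finset V) : Prop :=
  IsModulator C G M ∧ ∀ M' : Finset V, IsModulator C G M' → M.card ≤ M'.card

/-!
In a `(P₃ + K₁)`-free graph a maximal independent set with at least three vertices can be taken to
be a colour class of an optimal colouring. Hence if such a set is removed from `G`, then either it
meets the modulator `M`, which pays for the new colour, or `χ(G - M)` drops by one. Once every
independent set has at most two vertices, an optimal colouring is a maximum matching of the
complement. None of this looks at `M`.

For the running time, a function is polynomial-time if its value can be tabulated in an array by a
program that reads its argument from arrays. Such functions are closed under composition,
quantification over vertices, and iteration over vertices of functions between types of
polynomially many bits. The blossom algorithm fits into this scheme by keeping, instead of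
contracted graphs, for every outer vertex `v` a maximum matching that misses `v`.
-/


/-! ## Polynomial-time functions -/
namespace Ram

@[simp] theorem State.setReg_reg (s : State) (x v : ℕ) :
    (s.setReg x v).reg = Function.update s.reg x v := rfl

@[simp] theorem State.setReg_arr (s : State) (x v : ℕ) : (s.setReg x v).arr = s.arr := rfl

@[simp] theorem State.setArr_reg (s : State) (a i v : ℕ) : (s.setArr a i v).reg = s.reg := rfl

@[simp] theorem State.setArr_arr (s : State) (a i v : ℕ) :
    (s.setArr a i v).arr = Function.update s.arr a (Function.update (s.arr a) i v) := rfl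

/-- The registers and the arrays with a number in `F` are the same in `s` and in `s'`. -/
def AgreeOn (F : Finset ℕ) (s s' : State) : Prop :=
  ∀ x ∈ F, s'.reg x = s.reg x ∧ s'.arr x = s.arr x

namespace AgreeOn

variable {F F' : Finset ℕ} {s s₁ s₂ : State} {a i x v : ℕ}

theorem refl (F : Finset ℕ) (s : State) : AgreeOn F s s := fun _ _ => ⟨rfl, rfl⟩

theorem trans (h : AgreeOn F s s₁) (h' : AgreeOn F s₁ s₂) : AgreeOn F s s₂ := fun x hx =>
  ⟨(h' x hx).1.trans (h x hx).1, (h' x hx).2.trans (h x hx).2⟩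

theorem mono (h : AgreeOn F s s₁) (hF : F' ⊆ F) : AgreeOn F' s s₁ := fun x hx => h x (hF hx)

theorem reg (h : AgreeOn F s s₁) (hx : x ∈ F) : s₁.reg x = s.reg x := (h x hx).1

theorem arr (h : AgreeOn F s s₁) (hx : x ∈ F) : s₁.arr x = s.arr x := (h x hx).2

theorem setReg (h : AgreeOn F s s₁) (hx : x ∉ F) : AgreeOn F s (s₁.setReg x v) := fun _ hy =>
  ⟨(Function.update_of_ne (ne_of_mem_of_not_mem hy hx) ..).trans (h.reg hy), h.arr hy⟩

theorem setArr (h : AgreeOn F s s₁) (ha : a ∉ F) : AgreeOn F s (s₁.setArr a i v) := fun _ hy =>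
  ⟨h.reg hy, (Function.update_of_ne (ne_of_mem_of_not_mem hy ha) ..).trans (h.arr hy)⟩

end AgreeOn

/-- Started in `s`, the program `P` halts after at most `T` steps in a state that satisfies `Q`. -/
def Runs (P : Program) (s : State) (T : ℕ) (Q : State → Prop) : Prop :=
  ∃ t s', Exec P s t s' ∧ t ≤ T ∧ Q s'

namespace Runs

variable {P P' : Program} {s : State} {T T' : ℕ} {Q R : State → Prop} {a c i x y z : ℕ}

theorem mono (h : Runs P s T R) (hT : T ≤ T') (hQ : ∀ s', R s' → Q s') : Runs P s T' Q := by
  obtain ⟨t, s', he, ht, hR⟩ := h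
  exact ⟨t, s', he, ht.trans hT, hQ _ hR⟩

theorem const (h : Q (s.setReg x c)) : Runs (.const x c) s 1 Q := ⟨_, _, .const .., le_rfl, h⟩

theorem add (h : Q (s.setReg x (s.reg y + s.reg z))) : Runs (.add x y z) s 1 Q :=
  ⟨_, _, .add .., le_rfl, h⟩

theorem sub (h : Q (s.setReg x (s.reg y - s.reg z))) : Runs (.sub x y z) s 1 Q :=
  ⟨_, _, .sub .., le_rfl, h⟩

theorem load (h : Q (s.setReg x (s.arr a (s.reg i)))) : Runs (.load x a i) s 1 Q :=
  ⟨_, _, .load .., le_rfl, h⟩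

theorem store (h : Q (s.setArr a (s.reg i) (s.reg x))) : Runs (.store a i x) s 1 Q :=
  ⟨_, _, .store .., le_rfl, h⟩

theorem seq (h : Runs P s T R) (h' : ∀ s₁, R s₁ → Runs P' s₁ T' Q) :
    Runs (.seq P P') s (T + T') Q := by
  obtain ⟨t, s₁, he, ht, hR⟩ := h
  obtain ⟨t', s₂, he', ht', hQ⟩ := h' s₁ hR
  exact ⟨_, _, .seq he he', by omega, hQ⟩

theorem ite (h : s.reg x ≠ 0 → Runs P s T Q) (h' : s.reg x = 0 → Runs P' s T' Q) :
    Runs (.ite x P P') s (T + T' + 1) Q := by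
  by_cases hx : s.reg x = 0
  · obtain ⟨t, s', he, ht, hQ⟩ := h' hx
    exact ⟨_, _, .ite_false hx he, by omega, hQ⟩
  · obtain ⟨t, s', he, ht, hQ⟩ := h hx
    exact ⟨_, _, .ite_true hx he, by omega, hQ⟩

end Runs

/-- `x := y`, for different registers `x` and `y` -/
def Program.move (x y : ℕ) : Program := .seq (.const x 0) (.add x x y)

theorem Runs.move {s : State} {Q : State → Prop} {x y : ℕ} (hxy : x ≠ y)
    (h : Q (s.setReg x (s.reg y))) : Runs (.move x y) s 2 Q := by
  refine ⟨2, _, .seq (.const ..) (.add ..), le_rfl, ?_⟩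
  simpa [State.setReg, hxy.symm] using h

/-- Run `body` with register `c` counting down from `m - 1` to `0`, where `m` is the content of
register `x`; register `o` holds the constant `1`. -/
def Program.count (o c x : ℕ) (body : Program) : Program :=
  .seq (.move c x) (.loop c (.seq (.const o 1) (.seq (.sub c c o) body)))

theorem Runs.loop {F : Finset ℕ} {o c m T : ℕ} {body : Program} {s : State}
    (J : ℕ → State → Prop) (hJF : ∀ i s s', AgreeOn F s s' → J i s → J i s')
    (hoF : o ∉ F) (hcF : c ∉ F) (hoc : o ≠ c)
    (hbody : ∀ i < m, ∀ s, J (i + 1) s → s.reg c = i →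
      Runs body s T fun s' => J i s' ∧ s'.reg c = i)
    (hJ : J m s) (hc : s.reg c = m) :
    Runs (.loop c (.seq (.const o 1) (.seq (.sub c c o) body))) s (m * (T + 3) + 1) (J 0) := by
  induction m generalizing s with
  | zero => exact ⟨_, _, .loop_done hc, by omega, hJ⟩
  | succ m ih =>
    have hstep : Runs (.seq (.const o 1) (.seq (.sub c c o) body)) s (1 + (1 + T))
        fun s' => J m s' ∧ s'.reg c = m := by
      refine (Runs.const rfl).seq ?_
      rintro _ rfl
      refine (Runs.sub rfl).seq ?_
      rintro _ rfl
      refine hbody m (by omega) _ (hJF _ s _ (((AgreeOn.refl F s).setReg hoF).setReg hcF) hJ) ?_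
      simp [hoc.symm, hc]
    obtain ⟨t, s₁, he, ht, hJ₁, hc₁⟩ := hstep
    obtain ⟨t', s₂, he', ht', hJ₂⟩ := ih (fun i hi => hbody i (by omega)) hJ₁ hc₁
    refine ⟨_, _, .loop_step (by omega) he he', ?_, hJ₂⟩
    rw [Nat.add_mul]; omega

/-- The invariant `J i` holds when the bodies for `i, …, m - 1` have been run. -/
theorem Runs.count {F : Finset ℕ} {o c x m T : ℕ} {body : Program} {s : State}
    (J : ℕ → State → Prop) (hJF : ∀ i s s', AgreeOn F s s' → J i s → J i s')
    (hoF : o ∉ F) (hcF : c ∉ F) (hoc : o ≠ c) (hxc : x ≠ c) (hx : s.reg x = m) (hJ : J m s)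
    (hbody : ∀ i < m, ∀ s, J (i + 1) s → s.reg c = i →
      Runs body s T fun s' => J i s' ∧ s'.reg c = i) :
    Runs (.count o c x body) s (m * (T + 3) + 3) (J 0) := by
  refine ((Runs.move hxc.symm rfl).seq ?_).mono
    (show 2 + (m * (T + 3) + 1) ≤ _ by omega) fun _ h => h
  rintro _ rfl
  exact Runs.loop J hJF hoF hcF hoc hbody (hJF _ s _ ((AgreeOn.refl F s).setReg hcF) hJ)
    (by simp [hx])

/-- `d := x * n + y`, where `n` is the content of register `0` -/
def Program.index (d o c x y : ℕ) : Program := .seq (.move d y) (.count o c 0 (.add d d x))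

theorem exists_runs_index {F : Finset ℕ} {d x y : ℕ} (h0 : 0 ∈ F) (hx : x ∈ F) (hy : y ∈ F)
    (hd : d ∉ F) : ∃ (P : Program) (p : Polynomial ℕ), ∀ (n : ℕ) (s : State), s.reg 0 = n →
      Runs P s (p.eval n) fun s' => AgreeOn F s s' ∧ s'.reg d = s.reg x * n + s.reg y := by
  obtain ⟨o, ho⟩ := Infinite.exists_notMem_finset (insert d F)
  obtain ⟨c, hc⟩ := Infinite.exists_notMem_finset (insert o (insert d F))
  simp only [Finset.mem_insert, not_or] at ho hc
  refine ⟨.index d o c x y, 2 + (.X * (1 + 3) + 3), fun n s hn => ?_⟩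
  have hloop : Runs (.count o c 0 (.add d d x)) (s.setReg d (s.reg y)) (n * (1 + 3) + 3)
      fun s' => AgreeOn F s s' ∧ s'.reg d + 0 * s.reg x = s.reg x * n + s.reg y := by
    refine Runs.count (F := insert d F)
      (fun i s' => AgreeOn F s s' ∧ s'.reg d + i * s.reg x = s.reg x * n + s.reg y)
      (fun i s₁ s₂ h => ?_) (by simp [ho]) (by simp [hc]) (by grind) (by grind)
      (by simp [ne_of_mem_of_not_mem h0 hd, hn]) ⟨(AgreeOn.refl F s).setReg hd, ?_⟩ ?_
    · rw [h.reg (Finset.mem_insert_self d F)]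
      exact And.imp_left fun h' => h'.trans (h.mono (Finset.subset_insert d F))
    · simp [mul_comm, add_comm]
    · rintro i - s₁ ⟨hs, hi⟩ hci
      refine Runs.add ⟨⟨hs.setReg hd, ?_⟩, ?_⟩
      · simp only [State.setReg_reg, Function.update_self, hs.reg hx, ← hi]; ring
      · simpa [hc] using hci
  simp only [Polynomial.eval_add, Polynomial.eval_mul, Polynomial.eval_X, Polynomial.eval_ofNat,
    Polynomial.eval_one]
  refine (Runs.move (ne_of_mem_of_not_mem hy hd).symm rfl).seq ?_
  rintro _ rfl
  simpa using hloop

theorem exists_runs_mul_pow (r : ℕ) {F : Finset ℕ} {d x : ℕ} (h0 : 0 ∈ F) (hx : x ∈ F)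
    (hd : d ∉ F) : ∃ (P : Program) (p : Polynomial ℕ), ∀ (n : ℕ) (s : State), s.reg 0 = n →
      Runs P s (p.eval n) fun s' => AgreeOn F s s' ∧ s'.reg d = s.reg x * n ^ r := by
  induction r generalizing d F with
  | zero =>
    refine ⟨.move d x, 2, fun n s _ => ?_⟩
    rw [Polynomial.eval_ofNat]
    exact Runs.move (ne_of_mem_of_not_mem hx hd).symm ⟨(AgreeOn.refl F s).setReg hd, by simp⟩
  | succ r ih =>
    obtain ⟨z, hz⟩ := Infinite.exists_notMem_finset (insert d F)
    obtain ⟨e, he⟩ := Infinite.exists_notMem_finset (insert d (insert z F))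
    simp only [Finset.mem_insert, not_or] at hz he
    obtain ⟨P, p, hP⟩ := ih (F := insert z F) (d := e) (by simp [h0]) (by simp [hx]) (by grind)
    obtain ⟨P', p', hP'⟩ := exists_runs_index (F := insert e (insert z F)) (d := d) (x := e)
      (y := z) (by simp [h0]) (by simp) (by simp) (by grind)
    refine ⟨.seq (.const z 0) (.seq P P'), 1 + (p + p'), fun n s hn => ?_⟩
    simp only [Polynomial.eval_add, Polynomial.eval_one]
    refine (Runs.const rfl).seq ?_
    rintro _ rfl
    have hF₁ : AgreeOn F s (s.setReg z 0) := (AgreeOn.refl F s).setReg hz.2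
    refine (hP n _ ((hF₁.reg h0).trans hn)).seq fun s₂ ⟨hF₂, hs₂⟩ => ?_
    have hF₂' := hF₁.trans (hF₂.mono (Finset.subset_insert z F))
    refine (hP' n s₂ ((hF₂'.reg h0).trans hn)).mono le_rfl fun s₃ ⟨hF₃, hs₃⟩ => ⟨?_, ?_⟩
    · exact hF₂'.trans (hF₃.mono (by grind))
    · rw [hs₃, hs₂, hF₁.reg hx, hF₂.reg (Finset.mem_insert_self z F), pow_succ]
      simp [mul_assoc]

theorem exists_runs_copy_cell {F : Finset ℕ} {a b c x y : ℕ} (hc : c ∈ F) (hy : y ∈ F)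
    (ha : a ∉ F) : ∃ P : Program, ∀ s : State, Runs P s 4 fun s' => AgreeOn F s s' ∧
      s'.arr a = Function.update (s.arr a) (s.reg y + s.reg c) (s.arr b (s.reg x + s.reg c)) := by
  obtain ⟨v, hv⟩ := Infinite.exists_notMem_finset F
  obtain ⟨w, hw⟩ := Infinite.exists_notMem_finset (insert v F)
  simp only [Finset.mem_insert, not_or] at hw
  refine ⟨.seq (.add v x c) (.seq (.load w b v) (.seq (.add v y c) (.store a v w))), fun s => ?_⟩
  refine ⟨_, _, .seq (.add ..) (.seq (.load ..) (.seq (.add ..) (.store ..))), le_rfl,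
    ((((AgreeOn.refl F s).setReg hv).setReg hw.2).setReg hv).setArr ha, ?_⟩
  simp [hw, ne_of_mem_of_not_mem hc hv, ne_of_mem_of_not_mem hc hw.2,
    ne_of_mem_of_not_mem hy hv, ne_of_mem_of_not_mem hy hw.2]

theorem exists_runs_copy {F : Finset ℕ} {a b x y m : ℕ} (hb : b ∈ F) (hx : x ∈ F)
    (hy : y ∈ F) (hm : m ∈ F) (ha : a ∉ F) : ∃ P : Program, ∀ s : State,
      Runs P s (s.reg m * 7 + 3) fun s' => AgreeOn F s s' ∧
        (∀ j < s.reg m, s'.arr a (s.reg y + j) = s.arr b (s.reg x + j)) ∧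
        ∀ k, k < s.reg y ∨ s.reg y + s.reg m ≤ k → s'.arr a k = s.arr a k := by
  obtain ⟨o, ho⟩ := Infinite.exists_notMem_finset (insert a F)
  obtain ⟨c, hc⟩ := Infinite.exists_notMem_finset (insert o (insert a F))
  simp only [Finset.mem_insert, not_or] at ho hc
  obtain ⟨P, hP⟩ := exists_runs_copy_cell (F := insert c F) (a := a) (b := b) (x := x) (y := y)
    (Finset.mem_insert_self c F) (by simp [hy]) (by grind)
  refine ⟨.count o c m P, fun s => ?_⟩
  refine (Runs.count (F := insert a F) (fun i s' => AgreeOn F s s' ∧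
    (∀ j < s.reg m, i ≤ j → s'.arr a (s.reg y + j) = s.arr b (s.reg x + j)) ∧
    ∀ k, k < s.reg y ∨ s.reg y + s.reg m ≤ k → s'.arr a k = s.arr a k) ?_ (by simp [ho])
    (by simp [hc]) (by grind) (ne_of_mem_of_not_mem hm hc.2.2) rfl
    ⟨AgreeOn.refl F s, by omega, fun _ _ => rfl⟩ ?_).mono le_rfl
    fun s' ⟨hF, hj, hk⟩ => ⟨hF, fun j h => hj j h (Nat.zero_le j), hk⟩
  · rintro i s₁ s₂ h
    rw [h.arr (Finset.mem_insert_self a F)]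
    exact And.imp_left fun h' => h'.trans (h.mono (Finset.subset_insert a F))
  · rintro i hi s₁ ⟨hF, hj, hk⟩ rfl
    refine (hP s₁).mono le_rfl fun s₂ ⟨hF₂, hs₂⟩ => ⟨⟨?_, fun j hjm hij => ?_, fun k h => ?_⟩, ?_⟩
    · exact hF.trans (hF₂.mono (Finset.subset_insert c F))
    · rw [hs₂, hF.reg hx, hF.reg hy, hF.arr hb]
      rcases hij.eq_or_lt with rfl | hlt
      · rw [Function.update_self]
      · rw [Function.update_of_ne (by omega), hj j hjm hlt]
    · rw [hs₂, hF.reg hy, Function.update_of_ne (by omega), hk k h]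
    · exact hF₂.reg (Finset.mem_insert_self c F)

theorem exists_runs_table_bounds (r : ℕ) {F : Finset ℕ} {x y x' y' m : ℕ} (h0 : 0 ∈ F)
    (hx : x ∈ F) (hy : y ∈ F) (hx' : x' ∉ F) (hy' : y' ∉ insert x' F)
    (hm : m ∉ insert y' (insert x' F)) : ∃ (P : Program) (p : Polynomial ℕ),
      ∀ (n : ℕ) (s : State), s.reg 0 = n → Runs P s (p.eval n) fun s' => AgreeOn F s s' ∧
        s'.reg x' = s.reg x * n ^ r ∧ s'.reg y' = s.reg y * n ^ r ∧ s'.reg m = n ^ r := by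
  obtain ⟨z, hz⟩ := Infinite.exists_notMem_finset (insert m (insert y' (insert x' F)))
  obtain ⟨P₁, p₁, hP₁⟩ := exists_runs_mul_pow r h0 hx hx'
  obtain ⟨P₂, p₂, hP₂⟩ := exists_runs_mul_pow r (F := insert x' F) (d := y')
    (Finset.mem_insert_of_mem h0) (Finset.mem_insert_of_mem hy) hy'
  obtain ⟨P₃, p₃, hP₃⟩ := exists_runs_mul_pow r (F := insert z (insert y' (insert x' F)))
    (d := m) (x := z) (by simp [h0]) (Finset.mem_insert_self ..) (by grind)
  refine ⟨.seq P₁ (.seq P₂ (.seq (.const z 1) P₃)), p₁ + (p₂ + (1 + p₃)), fun n s hn => ?_⟩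
  simp only [Polynomial.eval_add, Polynomial.eval_one]
  refine (hP₁ n s hn).seq fun s₁ ⟨hF₁, hx₁⟩ => ?_
  refine (hP₂ n s₁ ((hF₁.reg h0).trans hn)).seq fun s₂ ⟨hF₂, hy₂⟩ => ?_
  refine (Runs.const rfl).seq ?_
  rintro _ rfl
  have hF₂' : AgreeOn (insert y' (insert x' F)) s₂ (s₂.setReg z 1) :=
    (AgreeOn.refl _ s₂).setReg (by grind)
  have hF₀ : AgreeOn F s (s₂.setReg z 1) :=
    (hF₁.trans (hF₂.mono (Finset.subset_insert x' F))).trans (hF₂'.mono (by grind))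
  refine (hP₃ n _ ((hF₀.reg h0).trans hn)).mono le_rfl fun s₃ ⟨hF₃, hm₃⟩ =>
    ⟨hF₀.trans (hF₃.mono (by grind)), ?_, ?_, by simp [hm₃]⟩
  · rw [hF₃.reg (by simp), hF₂'.reg (by simp), hF₂.reg (by simp), hx₁]
  · rw [hF₃.reg (by simp), hF₂'.reg (by simp), hy₂, hF₁.reg hy]

theorem exists_runs_copy_table (r : ℕ) {F : Finset ℕ} {a b x y : ℕ} (h0 : 0 ∈ F) (hb : b ∈ F)
    (hx : x ∈ F) (hy : y ∈ F) (ha : a ∉ F) : ∃ (P : Program) (p : Polynomial ℕ),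
      ∀ (n : ℕ) (s : State), s.reg 0 = n → Runs P s (p.eval n) fun s' => AgreeOn F s s' ∧
        (∀ j < n ^ r, s'.arr a (s.reg y * n ^ r + j) = s.arr b (s.reg x * n ^ r + j)) ∧
        ∀ k ≠ s.reg y, ∀ j < n ^ r, s'.arr a (k * n ^ r + j) = s.arr a (k * n ^ r + j) := by
  obtain ⟨x', hx'⟩ := Infinite.exists_notMem_finset (insert a F)
  obtain ⟨y', hy'⟩ := Infinite.exists_notMem_finset (insert x' (insert a F))
  obtain ⟨m, hm⟩ := Infinite.exists_notMem_finset (insert y' (insert x' (insert a F)))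
  obtain ⟨P, p, hP⟩ := exists_runs_table_bounds r (F := insert a F) (x := x) (y := y)
    (Finset.mem_insert_of_mem h0) (Finset.mem_insert_of_mem hx) (Finset.mem_insert_of_mem hy)
    hx' hy' hm
  simp only [Finset.mem_insert, not_or] at hx' hy' hm
  obtain ⟨P', hP'⟩ := exists_runs_copy (F := insert m (insert y' (insert x' F))) (a := a) (b := b)
    (x := x') (y := y') (m := m) (by simp [hb]) (by simp) (by simp) (by simp) (by grind)
  refine ⟨.seq P P', p + (.X ^ r * 7 + 3), fun n s hn => ?_⟩
  simp only [Polynomial.eval_add, Polynomial.eval_mul, Polynomial.eval_pow, Polynomial.eval_X,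
    Polynomial.eval_ofNat]
  refine (hP n s hn).seq fun s₁ ⟨hF₁, hx₁, hy₁, hm₁⟩ => ?_
  have hP₁ := hP' s₁
  simp only [hx₁, hy₁, hm₁] at hP₁
  refine hP₁.mono le_rfl fun s₂ ⟨hF₂, hcopy, hrest⟩ => ⟨?_, fun j hj => ?_, fun k hk j hj => ?_⟩
  · exact (hF₁.mono (Finset.subset_insert a F)).trans (hF₂.mono (by grind))
  · rw [hcopy j hj, hF₁.arr (Finset.mem_insert_of_mem hb)]
  · rw [hrest, hF₁.arr (Finset.mem_insert_self a F)]
    rcases hk.lt_or_gt with h | h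
    · exact .inl ((by nlinarith : k * n ^ r + j < (k + 1) * n ^ r).trans_le
        (Nat.mul_le_mul_right _ h))
    · exact .inr ((by nlinarith : _ ≤ (s.reg y + 1) * n ^ r).trans
        ((Nat.mul_le_mul_right _ h).trans (Nat.le_add_right _ _)))

/-- Families of types of which an element, for the parameter `n`, is kept in `n ^ rank` consecutive
cells of an array: `Rep A o x` says that the table at offset `o` of the array `A`, which consists of
the cells `o * n ^ rank + j` with `j < n ^ rank`, represents `x`. -/
class Table (T : ℕ → Type) where
  rank : ℕ
  Rep {n : ℕ} (A : ℕ → ℕ) (o : ℕ) (x : T n) : Prop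
  rep_shift {n : ℕ} {A A' : ℕ → ℕ} {o o' : ℕ} {x : T n}
    (h : ∀ j < n ^ rank, A' (o' * n ^ rank + j) = A (o * n ^ rank + j)) (hx : Rep A o x) :
    Rep A' o' x

instance : Table fun _ => Prop where
  rank := 0
  Rep A o p := A o ≠ 0 ↔ p
  rep_shift h hx := by
    have h0 := h 0 (by simp)
    simp only [pow_zero, mul_one, add_zero] at h0
    rwa [h0]

instance : Table fun n => Fin n where
  rank := 0
  Rep A o i := A o = i
  rep_shift h hx := by
    have h0 := h 0 (by simp)
    simp only [pow_zero, mul_one, add_zero] at h0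
    rwa [h0]

instance {T : ℕ → Type} [Table T] : Table fun n => Fin n → T n where
  rank := Table.rank T + 1
  Rep {n} A o f := ∀ i : Fin n, Table.Rep A (o * n + i) (f i)
  rep_shift {n} _ _ _ _ _ h hf i := by
    refine Table.rep_shift (fun j hj => ?_) (hf i)
    have hij : i * n ^ Table.rank T + j < n ^ (Table.rank T + 1) := by
      rw [pow_succ']
      exact (by nlinarith : _ < (i + 1) * n ^ Table.rank T).trans_le
        (Nat.mul_le_mul_right _ i.isLt)
    convert h _ hij using 2 <;> ring

instance : Table fun n => Set (Fin n) := inferInstanceAs (Table fun n => Fin n → Prop)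

instance : Table fun n => SimpleGraph (Fin n) where
  rank := 2
  Rep A o G := Table.Rep (T := fun n => Fin n → Fin n → Prop) A o G.Adj
  rep_shift h hG := Table.rep_shift (T := fun n => Fin n → Fin n → Prop) h hG

/-- Families of types whose elements are kept at locations in the memory; the element at a location
is determined by the registers and the arrays in the support of the location. -/
class Data (Γ : ℕ → Type) where
  Loc : Type
  supp : Loc → Finset ℕ
  Rep {n : ℕ} (ℓ : Loc) (s : State) (x : Γ n) : Prop
  rep_congr {n : ℕ} {ℓ : Loc} {s s₁ : State} {x : Γ n} (h : AgreeOn (supp ℓ) s s₁)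
    (hx : Rep ℓ s x) : Rep ℓ s₁ x

/-- The location `(a, x)` is the table of the array `a` at the offset in register `x`. -/
instance {T : ℕ → Type} [Table T] : Data T where
  Loc := ℕ × ℕ
  supp ℓ := {ℓ.1, ℓ.2}
  Rep ℓ s x := Table.Rep (s.arr ℓ.1) (s.reg ℓ.2) x
  rep_congr h hx := by rwa [h.arr (by simp), h.reg (by simp)]

instance {Γ Δ : ℕ → Type} [Data Γ] [Data Δ] : Data fun n => Γ n × Δ n where
  Loc := Data.Loc Γ × Data.Loc Δ
  supp ℓ := Data.supp ℓ.1 ∪ Data.supp ℓ.2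
  Rep ℓ s x := Data.Rep ℓ.1 s x.1 ∧ Data.Rep ℓ.2 s x.2
  rep_congr h hx := ⟨Data.rep_congr (h.mono Finset.subset_union_left) hx.1,
    Data.rep_congr (h.mono Finset.subset_union_right) hx.2⟩

section Realizes

variable {Γ Δ Θ : ℕ → Type} [Data Γ] [Data Δ] [Data Θ] {F F' : Finset ℕ}

/-- Some program computes `f` in polynomial time: it reads its argument at `ℓ`, leaves the value at
`ℓ'`, and keeps the registers and the arrays in `F`. Register `0` holds the parameter `n`. -/
def Realizes (F : Finset ℕ) (ℓ : Data.Loc Γ) (ℓ' : Data.Loc Δ) (f : ∀ n, Γ n → Δ n) : Prop :=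
  ∃ (P : Program) (p : Polynomial ℕ), ∀ (n : ℕ) (x : Γ n) (s : State), s.reg 0 = n →
    Data.Rep ℓ s x → Runs P s (p.eval n) fun s' => AgreeOn F s s' ∧ Data.Rep ℓ' s' (f n x)

theorem Realizes.of_rep {ℓ : Data.Loc Γ} {ℓ' : Data.Loc Δ} {f : ∀ n, Γ n → Δ n}
    (h : ∀ n x s, Data.Rep ℓ s x → Data.Rep ℓ' s (f n x)) : Realizes F ℓ ℓ' f := by
  obtain ⟨z, hz⟩ := Infinite.exists_notMem_finset (F ∪ Data.supp ℓ')
  rw [Finset.mem_union, not_or] at hz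
  refine ⟨.const z 0, 1, fun n x s _ hx => ?_⟩
  rw [Polynomial.eval_one]
  exact Runs.const ⟨(AgreeOn.refl F s).setReg hz.1,
    Data.rep_congr ((AgreeOn.refl _ s).setReg hz.2) (h n x s hx)⟩

theorem Realizes.mono {ℓ : Data.Loc Γ} {ℓ' : Data.Loc Δ} {f : ∀ n, Γ n → Δ n}
    (h : Realizes F ℓ ℓ' f) (hF : F' ⊆ F) : Realizes F' ℓ ℓ' f := by
  obtain ⟨P, p, hP⟩ := h
  exact ⟨P, p, fun n x s hn hx => (hP n x s hn hx).mono le_rfl fun _ h => ⟨h.1.mono hF, h.2⟩⟩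

theorem Realizes.comp {ℓ : Data.Loc Γ} {ℓ₁ : Data.Loc Δ} {ℓ₂ : Data.Loc Θ} {f : ∀ n, Γ n → Δ n}
    {g : ∀ n, Δ n → Θ n} (hg : Realizes F ℓ₁ ℓ₂ g) (hf : Realizes F ℓ ℓ₁ f) (h0 : 0 ∈ F) :
    Realizes F ℓ ℓ₂ fun n x => g n (f n x) := by
  obtain ⟨P, p, hP⟩ := hf
  obtain ⟨P', p', hP'⟩ := hg
  refine ⟨.seq P P', p + p', fun n x s hn hx => ?_⟩
  rw [Polynomial.eval_add]
  refine (hP n x s hn hx).seq fun s₁ ⟨hF₁, h₁⟩ => ?_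
  exact (hP' n _ s₁ ((hF₁.reg h0).trans hn) h₁).mono le_rfl fun s₂ h => ⟨hF₁.trans h.1, h.2⟩

theorem Realizes.prodMk {ℓ : Data.Loc Γ} {ℓ₁ : Data.Loc Δ} {ℓ₂ : Data.Loc Θ}
    {f : ∀ n, Γ n → Δ n} {g : ∀ n, Γ n → Θ n} (hf : Realizes F ℓ ℓ₁ f)
    (hg : Realizes (F ∪ Data.supp ℓ₁) ℓ ℓ₂ g) (h0 : 0 ∈ F) (hℓ : Data.supp ℓ ⊆ F) :
    Realizes (Δ := fun n => Δ n × Θ n) F ℓ (ℓ₁, ℓ₂) fun n x => (f n x, g n x) := by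
  obtain ⟨P, p, hP⟩ := hf
  obtain ⟨P', p', hP'⟩ := hg
  refine ⟨.seq P P', p + p', fun n x s hn hx => ?_⟩
  rw [Polynomial.eval_add]
  refine (hP n x s hn hx).seq fun s₁ ⟨hF₁, h₁⟩ => ?_
  refine (hP' n x s₁ ((hF₁.reg h0).trans hn) (Data.rep_congr (hF₁.mono hℓ) hx)).mono le_rfl
    fun s₂ ⟨hF₂, h₂⟩ => ⟨hF₁.trans (hF₂.mono Finset.subset_union_left), ?_, h₂⟩
  exact Data.rep_congr (hF₂.mono Finset.subset_union_right) h₁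

/-- Every value can be copied to the location `ℓ'`. -/
def IsTarget (ℓ' : Data.Loc Δ) : Prop :=
  ∀ (F : Finset ℕ) (ℓ : Data.Loc Δ), 0 ∈ F → Data.supp ℓ ⊆ F → Disjoint (Data.supp ℓ') F →
    Realizes F ℓ ℓ' fun _ x => x

/-- There are arbitrarily many locations to which values can be copied. -/
class Storable (Δ : ℕ → Type) [Data Δ] : Prop where
  exists_isTarget (F : Finset ℕ) : ∃ ℓ : Data.Loc Δ, IsTarget ℓ ∧ Disjoint (Data.supp ℓ) F

theorem isTarget_of_ne {T : ℕ → Type} [Table T] {a x : ℕ} (hax : a ≠ x) :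
    IsTarget (Δ := T) (a, x) := by
  rintro F ℓ h0 hℓ hF
  simp only [Data.supp, Finset.disjoint_insert_left, Finset.disjoint_singleton_left,
    Finset.insert_subset_iff, Finset.singleton_subset_iff] at hF hℓ
  obtain ⟨P, p, hP⟩ := exists_runs_copy_table (Table.rank T) (F := insert x F) (a := a)
    (Finset.mem_insert_of_mem h0) (Finset.mem_insert_of_mem hℓ.1) (Finset.mem_insert_of_mem hℓ.2)
    (Finset.mem_insert_self x F) (by simp [hax, hF.1])
  refine ⟨.seq (.const x 0) P, 1 + p, fun n t s hn ht => ?_⟩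
  rw [Polynomial.eval_add, Polynomial.eval_one]
  refine (Runs.const rfl).seq ?_
  rintro _ rfl
  have hF₁ : AgreeOn F s (s.setReg x 0) := (AgreeOn.refl F s).setReg hF.2
  refine (hP n _ ((hF₁.reg h0).trans hn)).mono le_rfl fun s₂ ⟨hF₂, hcopy, _⟩ =>
    ⟨hF₁.trans (hF₂.mono (Finset.subset_insert x F)), Table.rep_shift ?_ ht⟩
  rwa [hF₁.reg hℓ.2, hF₁.arr hℓ.1, ← hF₂.reg (Finset.mem_insert_self x F)] at hcopy

instance {T : ℕ → Type} [Table T] : Storable T where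
  exists_isTarget F := by
    obtain ⟨a, ha⟩ := Infinite.exists_notMem_finset F
    obtain ⟨x, hx⟩ := Infinite.exists_notMem_finset (insert a F)
    rw [Finset.mem_insert, not_or] at hx
    exact ⟨(a, x), isTarget_of_ne (Ne.symm hx.1), by simp [Data.supp, ha, hx.2]⟩

instance [Storable Δ] [Storable Θ] : Storable fun n => Δ n × Θ n where
  exists_isTarget F := by
    obtain ⟨ℓ₁, h₁, hF₁⟩ := Storable.exists_isTarget (Δ := Δ) F
    obtain ⟨ℓ₂, h₂, hF₂⟩ := Storable.exists_isTarget (Δ := Θ) (F ∪ Data.supp ℓ₁)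
    rw [Finset.disjoint_union_right] at hF₂
    refine ⟨(ℓ₁, ℓ₂), fun F' ℓ h0 hℓ hF' => ?_, by simp [Data.supp, hF₁, hF₂.1]⟩
    simp only [Data.supp, Finset.union_subset_iff, Finset.disjoint_union_left] at hℓ hF'
    obtain ⟨P, p, hP⟩ := h₁ F' ℓ.1 h0 hℓ.1 hF'.1
    obtain ⟨P', p', hP'⟩ := h₂ (F' ∪ Data.supp ℓ₁) ℓ.2 (Finset.mem_union_left _ h0)
      (hℓ.2.trans Finset.subset_union_left) (Finset.disjoint_union_right.2 ⟨hF'.2, hF₂.2⟩)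
    exact Realizes.prodMk (Γ := fun n => Δ n × Θ n) (f := fun _ x => x.1) (g := fun _ x => x.2)
      ⟨P, p, fun n x s hn hx => hP n x.1 s hn hx.1⟩
      ⟨P', p', fun n x s hn hx => hP' n x.2 s hn hx.2⟩ h0 (Finset.union_subset hℓ.1 hℓ.2)

end Realizes

/-- The functions `f n` are computed in time polynomial in `n`, for an argument at any location. -/
def PolyTime {Γ Δ : ℕ → Type} [Data Γ] [Data Δ] (f : ∀ n, Γ n → Δ n) : Prop :=
  ∀ (F : Finset ℕ) (ℓ : Data.Loc Γ), 0 ∈ F → Data.supp ℓ ⊆ F →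
    ∃ ℓ₁ : Data.Loc Δ, Realizes F ℓ ℓ₁ f

/-- The functions `f n` of two arguments are computed in time polynomial in `n`. -/
abbrev PolyTime₂ {Γ Δ Θ : ℕ → Type} [Data Γ] [Data Δ] [Data Θ] (f : ∀ n, Γ n → Δ n → Θ n) : Prop :=
  PolyTime fun n (x : Γ n × Δ n) => f n x.1 x.2

theorem PolyTime.realizes {Γ Δ : ℕ → Type} [Data Γ] [Data Δ] [Storable Δ] {f : ∀ n, Γ n → Δ n}
    (hf : PolyTime f) {F : Finset ℕ} {ℓ : Data.Loc Γ} {ℓ' : Data.Loc Δ} (hℓ' : IsTarget ℓ')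
    (h0 : 0 ∈ F) (hℓ : Data.supp ℓ ⊆ F) (hF : Disjoint (Data.supp ℓ') F) :
    Realizes F ℓ ℓ' f := by
  obtain ⟨ℓ₁, h₁⟩ := hf F ℓ h0 hℓ
  -- The value may lie at a location that overlaps `ℓ'`, so it is copied to `ℓ'` in two stages.
  obtain ⟨ℓ₂, h₂, hF₂⟩ := Storable.exists_isTarget (Δ := Δ) (F ∪ Data.supp ℓ₁ ∪ Data.supp ℓ')
  rw [Finset.disjoint_union_right] at hF₂
  have hcopy₁ : Realizes F ℓ₁ ℓ₂ fun _ x => x :=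
    (h₂ _ ℓ₁ (Finset.mem_union_left _ h0) Finset.subset_union_right hF₂.1).mono
      Finset.subset_union_left
  have hcopy₂ : Realizes F ℓ₂ ℓ' fun _ x => x :=
    (hℓ' (F ∪ Data.supp ℓ₂) ℓ₂ (Finset.mem_union_left _ h0) Finset.subset_union_right
      (Finset.disjoint_union_right.2 ⟨hF, hF₂.2.symm⟩)).mono Finset.subset_union_left
  exact hcopy₂.comp (hcopy₁.comp h₁ h0) h0

theorem exists_runs_store_cell {F : Finset ℕ} {c : ℕ} (hc : c ∈ F) :
    ∃ (P : Program) (a x : ℕ), a ∉ F ∧ x ∉ F ∧ a ≠ x ∧ ∀ s : State,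
      Runs P s 2 fun s' => AgreeOn F s s' ∧ s'.arr a (s'.reg x) = s.reg c := by
  obtain ⟨a, ha⟩ := Infinite.exists_notMem_finset F
  obtain ⟨x, hx⟩ := Infinite.exists_notMem_finset (insert a F)
  rw [Finset.mem_insert, not_or] at hx
  refine ⟨.seq (.const x 0) (.store a x c), a, x, ha, hx.2, Ne.symm hx.1, fun s => ?_⟩
  refine ⟨_, _, .seq (.const ..) (.store ..), le_rfl,
    ((AgreeOn.refl F s).setReg hx.2).setArr ha, ?_⟩
  simp [ne_of_mem_of_not_mem hc hx.2]

theorem rep_graphInput {n : ℕ} (G : SimpleGraph (Fin n)) :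
    Data.Rep (Γ := fun n => SimpleGraph (Fin n)) (0, 2) (graphInput G) G := by
  intro u v
  have hindex : (∃ u' v' : Fin n, u * n + v = u' * n + (v' : ℕ) ∧ G.Adj u' v') ↔ G.Adj u v := by
    refine ⟨fun ⟨u', v', h, hadj⟩ => ?_, fun h => ⟨u, v, rfl, h⟩⟩
    have huv : (u, v) = (u', v') := finProdFinEquiv.injective <| Fin.ext <| by
      simpa [add_comm, mul_comm] using h
    rwa [Prod.mk_inj.1 huv |>.1, Prod.mk_inj.1 huv |>.2]
  simp [graphInput, Table.Rep, hindex]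

namespace PolyTime

variable {Γ Δ Θ : ℕ → Type} [Data Γ] [Data Δ] [Data Θ]

protected theorem id : PolyTime fun n (x : Γ n) => x := fun _ ℓ _ _ =>
  ⟨ℓ, .of_rep fun _ _ _ h => h⟩

theorem comp {f : ∀ n, Γ n → Δ n} {g : ∀ n, Δ n → Θ n} (hg : PolyTime g) (hf : PolyTime f) :
    PolyTime fun n x => g n (f n x) := by
  intro F ℓ h0 hℓ
  obtain ⟨ℓ₁, h₁⟩ := hf F ℓ h0 hℓ
  obtain ⟨ℓ₂, h₂⟩ := hg (F ∪ Data.supp ℓ₁) ℓ₁ (Finset.mem_union_left _ h0)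
    Finset.subset_union_right
  exact ⟨ℓ₂, (h₂.mono Finset.subset_union_left).comp h₁ h0⟩

theorem prodMk {f : ∀ n, Γ n → Δ n} {g : ∀ n, Γ n → Θ n} (hf : PolyTime f) (hg : PolyTime g) :
    PolyTime (Δ := fun n => Δ n × Θ n) fun n x => (f n x, g n x) := by
  intro F ℓ h0 hℓ
  obtain ⟨ℓ₁, h₁⟩ := hf F ℓ h0 hℓ
  obtain ⟨ℓ₂, h₂⟩ := hg (F ∪ Data.supp ℓ₁) ℓ (Finset.mem_union_left _ h0)
    (hℓ.trans Finset.subset_union_left)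
  exact ⟨(ℓ₁, ℓ₂), h₁.prodMk h₂ h0 hℓ⟩

theorem fst {f : ∀ n, Γ n → Δ n × Θ n} (hf : PolyTime f) : PolyTime fun n x => (f n x).1 :=
  comp (Δ := fun n => Δ n × Θ n) (g := fun _ y => y.1)
    (fun _ ℓ _ _ => ⟨ℓ.1, .of_rep fun _ _ _ h => h.1⟩) hf

theorem snd {f : ∀ n, Γ n → Δ n × Θ n} (hf : PolyTime f) : PolyTime fun n x => (f n x).2 :=
  comp (Δ := fun n => Δ n × Θ n) (g := fun _ y => y.2)
    (fun _ ℓ _ _ => ⟨ℓ.2, .of_rep fun _ _ _ h => h.2⟩) hf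

theorem adj {G : ∀ n, Γ n → SimpleGraph (Fin n)} (hG : PolyTime G) :
    PolyTime fun n x => (G n x).Adj :=
  comp (Δ := fun n => SimpleGraph (Fin n)) (g := fun _ H => H.Adj)
    (fun _ ℓ _ _ => ⟨ℓ, .of_rep fun _ _ _ h => h⟩) hG

theorem of_adj {G : ∀ n, Γ n → SimpleGraph (Fin n)} (hG : PolyTime fun n x => (G n x).Adj) :
    PolyTime G := fun F ℓ h0 hℓ => hG F ℓ h0 hℓ

protected theorem const {p : Prop} : PolyTime fun n (_ : Γ n) => p := by
  classical
  intro F ℓ _ _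
  obtain ⟨r, hr⟩ := Infinite.exists_notMem_finset F
  obtain ⟨P, a, x, -, -, -, hP⟩ := exists_runs_store_cell (Finset.mem_insert_self r F)
  refine ⟨(a, x), .seq (.const r (if p then 1 else 0)) P, 1 + 2, fun n t s _ _ => ?_⟩
  simp only [Polynomial.eval_add, Polynomial.eval_one, Polynomial.eval_ofNat]
  refine (Runs.const rfl).seq ?_
  rintro _ rfl
  refine (hP _).mono le_rfl fun s' ⟨hF, hs'⟩ =>
    ⟨((AgreeOn.refl F s).setReg hr).trans (hF.mono (Finset.subset_insert r F)), ?_⟩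
  simp [Data.Rep, Table.Rep, hs']

protected theorem eq {i j : ∀ n, Γ n → Fin n} (hi : PolyTime i) (hj : PolyTime j) :
    PolyTime fun n x => i n x = j n x := by
  suffices h : PolyTime (Γ := fun n => Fin n × Fin n) fun _ y => y.1 = y.2 from
    h.comp (hi.prodMk hj)
  intro F ⟨⟨a, x⟩, b, y⟩ _ hℓ
  simp only [Data.supp, Finset.union_subset_iff, Finset.insert_subset_iff,
    Finset.singleton_subset_iff] at hℓ
  obtain ⟨u, hu⟩ := Infinite.exists_notMem_finset F
  obtain ⟨v, hv⟩ := Infinite.exists_notMem_finset (insert u F)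
  obtain ⟨w, hw⟩ := Infinite.exists_notMem_finset (insert v (insert u F))
  simp only [Finset.mem_insert, not_or] at hv hw
  obtain ⟨P, c, z, -, -, -, hP⟩ := exists_runs_store_cell (Finset.mem_insert_self w F)
  -- With truncated subtraction, `1 - ((i - j) + (j - i))` is `1` if `i = j`, and `0` otherwise.
  refine ⟨(c, z), .seq (.seq (.load u a x) (.seq (.load v b y) (.seq (.sub w u v)
    (.seq (.sub v v u) (.seq (.add u v w) (.seq (.const w 1) (.sub w w u))))))) P,
    7 + 2, fun n ⟨i, j⟩ s _ ⟨hi, hj⟩ => ?_⟩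
  replace hi : s.arr a (s.reg x) = i := hi
  replace hj : s.arr b (s.reg y) = j := hj
  simp only [Polynomial.eval_add, Polynomial.eval_ofNat]
  refine Runs.seq (R := fun s' => AgreeOn F s s' ∧ (s'.reg w ≠ 0 ↔ i = j)) ⟨_, _, .seq (.load ..)
    (.seq (.load ..) (.seq (.sub ..) (.seq (.sub ..) (.seq (.add ..) (.seq (.const ..)
    (.sub ..)))))), le_rfl, ?_, ?_⟩ fun s₁ ⟨hF₁, hw₁⟩ => (hP s₁).mono le_rfl
    fun s₂ ⟨hF₂, hs₂⟩ => ⟨hF₁.trans (hF₂.mono (Finset.subset_insert w F)), ?_⟩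
  · exact (((((((AgreeOn.refl F s).setReg hu).setReg hv.2).setReg hw.2.2).setReg hv.2).setReg
      hu).setReg hw.2.2).setReg hw.2.2
  · simp only [hi, hj, hw, Ne.symm hw.1, Ne.symm hv.1, Ne.symm hw.2.1, ne_eq, not_false_eq_true,
      ne_of_mem_of_not_mem hℓ.2.2 hu, State.setReg_reg, State.setReg_arr, Function.update_self,
      Function.update_of_ne, Fin.ext_iff]
    omega
  · rwa [← hs₂] at hw₁

protected theorem ite [Storable Δ] {φ : ∀ n, Γ n → Prop} {dec : ∀ n x, Decidable (φ n x)}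
    {f g : ∀ n, Γ n → Δ n} (hφ : PolyTime φ) (hf : PolyTime f) (hg : PolyTime g) :
    PolyTime fun n x => if φ n x then f n x else g n x := by
  classical
  suffices h : PolyTime (Γ := fun n => Prop × (Δ n × Δ n))
      fun _ y => if y.1 then y.2.1 else y.2.2 by
    convert h.comp (hφ.prodMk (hf.prodMk hg))
  rintro F ⟨⟨a, x⟩, ℓ₁, ℓ₂⟩ h0 hℓ
  obtain ⟨ℓ', hℓ', hF⟩ := Storable.exists_isTarget (Δ := Δ) F
  obtain ⟨r, hr⟩ := Infinite.exists_notMem_finset F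
  simp only [Data.supp, Finset.union_subset_iff] at hℓ
  obtain ⟨P₁, p₁, hP₁⟩ := hℓ' F ℓ₁ h0 hℓ.2.1 hF
  obtain ⟨P₂, p₂, hP₂⟩ := hℓ' F ℓ₂ h0 hℓ.2.2 hF
  refine ⟨ℓ', .seq (.load r a x) (.ite r P₁ P₂), 1 + (p₁ + p₂ + 1), fun n t s hn ht => ?_⟩
  simp only [Polynomial.eval_add, Polynomial.eval_one]
  refine (Runs.load rfl).seq ?_
  rintro _ rfl
  have hF' : AgreeOn F s (s.setReg r (s.arr a (s.reg x))) := (AgreeOn.refl F s).setReg hr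
  have hφ : (s.setReg r (s.arr a (s.reg x))).reg r ≠ 0 ↔ t.1 := by
    rw [State.setReg_reg, Function.update_self]; exact ht.1
  refine Runs.ite (fun h => ?_) fun h => ?_
  · rw [if_pos (hφ.1 h)]
    exact (hP₁ n t.2.1 _ ((hF'.reg h0).trans hn) (Data.rep_congr (hF'.mono hℓ.2.1) ht.2.1)).mono
      le_rfl fun _ h' => ⟨hF'.trans h'.1, h'.2⟩
  · rw [if_neg fun h' => hφ.2 h' h]
    exact (hP₂ n t.2.2 _ ((hF'.reg h0).trans hn) (Data.rep_congr (hF'.mono hℓ.2.2) ht.2.2)).mono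
      le_rfl fun _ h' => ⟨hF'.trans h'.1, h'.2⟩

theorem app {T : ℕ → Type} [Table T] {f : ∀ n, Γ n → Fin n → T n} {i : ∀ n, Γ n → Fin n}
    (hf : PolyTime f) (hi : PolyTime i) : PolyTime fun n x => f n x (i n x) := by
  suffices h : PolyTime (Γ := fun n => (Fin n → T n) × Fin n) fun _ y => y.1 y.2 from
    h.comp (hf.prodMk hi)
  intro F ⟨⟨a, x⟩, b, y⟩ h0 hℓ
  simp only [Data.supp, Finset.union_subset_iff, Finset.insert_subset_iff,
    Finset.singleton_subset_iff] at hℓ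
  obtain ⟨v, hv⟩ := Infinite.exists_notMem_finset F
  obtain ⟨d, hd⟩ := Infinite.exists_notMem_finset (insert v F)
  obtain ⟨P, p, hP⟩ := exists_runs_index (Finset.mem_insert_of_mem h0)
    (Finset.mem_insert_of_mem hℓ.1.2) (Finset.mem_insert_self v F) hd
  refine ⟨(a, d), .seq (.load v b y) P, 1 + p, fun n ⟨f, i⟩ s hn ⟨hf, hi⟩ => ?_⟩
  rw [Polynomial.eval_add, Polynomial.eval_one]
  refine (Runs.load rfl).seq ?_
  rintro _ rfl
  have hF₁ : AgreeOn F s (s.setReg v (s.arr b (s.reg y))) := (AgreeOn.refl F s).setReg hv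
  refine (hP n _ ((hF₁.reg h0).trans hn)).mono le_rfl fun s₂ ⟨hF₂, hd₂⟩ => ?_
  have hF : AgreeOn F s s₂ := hF₁.trans (hF₂.mono (Finset.subset_insert v F))
  refine ⟨hF, ?_⟩
  have hi' : s.arr b (s.reg y) = i := hi
  have hdi : s₂.reg d = s.reg x * n + i := by
    rw [hd₂, hF₁.reg hℓ.1.2, State.setReg_reg, Function.update_self, hi']
  simpa only [Data.Rep, hdi, hF.arr hℓ.1.1] using hf i

theorem exists_runs_of_reg [Storable Δ] {f : ∀ n, Γ n → Fin n → Δ n} (hf : PolyTime₂ f)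
    {F : Finset ℕ} {ℓ : Data.Loc Γ} {c : ℕ} (h0 : 0 ∈ F) (hℓ : Data.supp ℓ ⊆ F) (hc : c ∈ F) :
    ∃ ℓ' : Data.Loc Δ, Disjoint (Data.supp ℓ') F ∧ ∃ (P : Program) (p : Polynomial ℕ),
      ∀ (n : ℕ) (x : Γ n) (i : Fin n) (s : State), s.reg 0 = n → Data.Rep ℓ s x → s.reg c = i →
        Runs P s (p.eval n) fun s' => AgreeOn F s s' ∧ Data.Rep ℓ' s' (f n x i) := by
  obtain ⟨P, a, y, -, -, -, hP⟩ := exists_runs_store_cell hc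
  obtain ⟨ℓ', hℓ', hF⟩ := Storable.exists_isTarget (Δ := Δ) (F ∪ {a, y})
  obtain ⟨P', p, hP'⟩ := hf.realizes (ℓ := (ℓ, (a, y))) hℓ' (Finset.mem_union_left _ h0)
    (Finset.union_subset_union_left hℓ) hF
  refine ⟨ℓ', (Finset.disjoint_union_right.1 hF).1, .seq P P', 2 + p, fun n x i s hn hx hi => ?_⟩
  rw [Polynomial.eval_add, Polynomial.eval_ofNat]
  refine (hP s).seq fun s₁ ⟨hF₁, hs₁⟩ => ?_
  exact (hP' n (x, i) s₁ ((hF₁.reg h0).trans hn)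
    ⟨Data.rep_congr (hF₁.mono hℓ) hx, hs₁.trans hi⟩).mono le_rfl
    fun s₂ ⟨hF₂, hs₂⟩ => ⟨hF₁.trans (hF₂.mono Finset.subset_union_left), hs₂⟩

theorem exists_runs_tabulate_step {T : ℕ → Type} [Table T] {f : ∀ n, Γ n → Fin n → T n}
    (hf : PolyTime₂ f) {F : Finset ℕ} {ℓ : Data.Loc Γ} {a c : ℕ} (h0 : 0 ∈ F)
    (hℓ : Data.supp ℓ ⊆ F) (hc : c ∈ F) (ha : a ∉ F) :
    ∃ (P : Program) (p : Polynomial ℕ), ∀ (n : ℕ) (x : Γ n) (i : Fin n) (s : State),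
      s.reg 0 = n → Data.Rep ℓ s x → s.reg c = i → Runs P s (p.eval n) fun s' =>
        AgreeOn F s s' ∧ Table.Rep (s'.arr a) i (f n x i) ∧
          ∀ (k : ℕ) (z : T n), k ≠ i → Table.Rep (s.arr a) k z → Table.Rep (s'.arr a) k z := by
  obtain ⟨ℓ', hF, P, p, hP⟩ := hf.exists_runs_of_reg (F := insert a F)
    (Finset.mem_insert_of_mem h0) (hℓ.trans (Finset.subset_insert a F))
    (Finset.mem_insert_of_mem hc)
  have ha' : a ∉ F ∪ Data.supp ℓ' := by
    rw [Finset.mem_union, not_or]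
    exact ⟨ha, Finset.disjoint_right.1 hF (Finset.mem_insert_self a F)⟩
  obtain ⟨P', p', hP'⟩ := exists_runs_copy_table (Table.rank T) (b := ℓ'.1) (x := ℓ'.2)
    (Finset.mem_union_left _ h0) (Finset.mem_union_right F (by simp [Data.supp]))
    (Finset.mem_union_right F (by simp [Data.supp])) (Finset.mem_union_left _ hc) ha'
  refine ⟨.seq P P', p + p', fun n x i s hn hx hi => ?_⟩
  rw [Polynomial.eval_add]
  refine (hP n x i s hn hx hi).seq fun s₁ ⟨hF₁, hs₁⟩ => ?_
  have hF₁' := hF₁.mono (Finset.subset_insert a F)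
  have hi' : s₁.reg c = i := (hF₁'.reg hc).trans hi
  refine (hP' n s₁ ((hF₁'.reg h0).trans hn)).mono le_rfl fun s₂ ⟨hF₂, hcopy, hrest⟩ =>
    ⟨hF₁'.trans (hF₂.mono Finset.subset_union_left), ?_, fun k z hk hz => ?_⟩
  · rw [hi'] at hcopy
    exact Table.rep_shift hcopy hs₁
  · rw [hi', hF₁.arr (Finset.mem_insert_self a F)] at hrest
    exact Table.rep_shift (hrest k hk) hz

theorem lam {T : ℕ → Type} [Table T] {f : ∀ n, Γ n → Fin n → T n} (hf : PolyTime₂ f) :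
    PolyTime f := by
  intro F ℓ h0 hℓ
  obtain ⟨c, hc⟩ := Infinite.exists_notMem_finset F
  obtain ⟨a, ha⟩ := Infinite.exists_notMem_finset (insert c F)
  obtain ⟨o, ho⟩ := Infinite.exists_notMem_finset (insert a (insert c F))
  obtain ⟨P, p, hP⟩ := hf.exists_runs_tabulate_step (Finset.mem_insert_of_mem h0)
    (hℓ.trans (Finset.subset_insert c F)) (Finset.mem_insert_self c F) ha
  simp only [Finset.mem_insert, not_or] at ha ho
  refine ⟨(a, o), .seq (.count o c 0 P) (.const o 0), .X * (p + 3) + 3 + 1,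
    fun n x s hn hx => ?_⟩
  simp only [Polynomial.eval_add, Polynomial.eval_mul, Polynomial.eval_X, Polynomial.eval_ofNat,
    Polynomial.eval_one]
  refine (Runs.count (F := insert a F) (fun i s' => AgreeOn F s s' ∧
      ∀ j : Fin n, i ≤ j → Table.Rep (s'.arr a) j (f n x j)) ?_ (by simp [ho]) ?_ ho.2.1
      (ne_of_mem_of_not_mem h0 hc) hn ⟨AgreeOn.refl F s, fun j h => absurd j.2 h.not_gt⟩ ?_).seq
    fun s₁ ⟨hF₁, hs₁⟩ => Runs.const ⟨hF₁.setReg ho.2.2, fun j => ?_⟩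
  · rintro i s₁ s₂ h
    rw [h.arr (Finset.mem_insert_self a F)]
    exact And.imp_left fun h' => h'.trans (h.mono (Finset.subset_insert a F))
  · simp [hc, Ne.symm ha.1]
  · rintro i hi s₁ ⟨hF₁, hs₁⟩ hci
    refine (hP n x ⟨i, hi⟩ s₁ ((hF₁.reg h0).trans hn) (Data.rep_congr (hF₁.mono hℓ) hx) hci).mono
      le_rfl fun s₂ ⟨hF₂, hnew, hold⟩ => ⟨⟨hF₁.trans (hF₂.mono (Finset.subset_insert c F)),
        fun j hij => ?_⟩, (hF₂.reg (Finset.mem_insert_self c F)).trans hci⟩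
    rcases hij.eq_or_lt with rfl | hlt
    · exact hnew
    · exact hold j _ hlt.ne' (hs₁ j hlt)
  · simpa using hs₁ j (Nat.zero_le j)

theorem exists_runs_foldr_step [Storable Δ] {f : ∀ n, Γ n → Fin n → Δ n → Δ n}
    (hf : PolyTime fun n (x : (Γ n × Δ n) × Fin n) => f n x.1.1 x.2 x.1.2) {F : Finset ℕ}
    {ℓ : Data.Loc Γ} {ℓ' : Data.Loc Δ} {c : ℕ} (h0 : 0 ∈ F) (hℓ : Data.supp ℓ ⊆ F) (hc : c ∈ F)
    (hℓ' : IsTarget ℓ') (hF : Disjoint (Data.supp ℓ') F) :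
    ∃ (P : Program) (p : Polynomial ℕ), ∀ (n : ℕ) (x : Γ n) (y : Δ n) (i : Fin n) (s : State),
      s.reg 0 = n → Data.Rep ℓ s x → Data.Rep ℓ' s y → s.reg c = i → Runs P s (p.eval n)
        fun s' => AgreeOn F s s' ∧ Data.Rep ℓ' s' (f n x i y) := by
  obtain ⟨ℓ₁, hF₁, P, p, hP⟩ := exists_runs_of_reg (Γ := fun n => Γ n × Δ n)
    (f := fun n x i => f n x.1 i x.2) hf (ℓ := (ℓ, ℓ')) (Finset.mem_union_left _ h0)
    (Finset.union_subset_union_left hℓ) (Finset.mem_union_left _ hc)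
  rw [Finset.disjoint_union_right] at hF₁
  obtain ⟨P', p', hP'⟩ := hℓ' (F ∪ Data.supp ℓ₁) ℓ₁ (Finset.mem_union_left _ h0)
    Finset.subset_union_right (Finset.disjoint_union_right.2 ⟨hF, hF₁.2.symm⟩)
  refine ⟨.seq P P', p + p', fun n x y i s hn hx hy hi => ?_⟩
  rw [Polynomial.eval_add]
  refine (hP n (x, y) i s hn ⟨hx, hy⟩ hi).seq fun s₁ ⟨hs₁, hz⟩ => ?_
  have hs₁' := hs₁.mono Finset.subset_union_left
  exact (hP' n _ s₁ ((hs₁'.reg h0).trans hn) hz).mono le_rfl fun s₂ ⟨hs₂, hz'⟩ =>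
    ⟨hs₁'.trans (hs₂.mono Finset.subset_union_left), hz'⟩

theorem foldr [Storable Δ] {f : ∀ n, Γ n → Fin n → Δ n → Δ n} {b : ∀ n, Γ n → Δ n}
    (hf : PolyTime fun n (x : (Γ n × Δ n) × Fin n) => f n x.1.1 x.2 x.1.2) (hb : PolyTime b) :
    PolyTime fun n x => (List.finRange n).foldr (f n x) (b n x) := by
  intro F ℓ h0 hℓ
  obtain ⟨c, hc⟩ := Infinite.exists_notMem_finset F
  obtain ⟨o, ho⟩ := Infinite.exists_notMem_finset (insert c F)
  obtain ⟨ℓ', hℓ', hF⟩ := Storable.exists_isTarget (Δ := Δ) (insert o (insert c F))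
  simp only [Finset.disjoint_insert_right] at hF
  obtain ⟨P, p, hP⟩ := hb.realizes hℓ' h0 hℓ hF.2.2
  obtain ⟨P', p', hP'⟩ := hf.exists_runs_foldr_step (Finset.mem_insert_of_mem h0)
    (hℓ.trans (Finset.subset_insert c F)) (Finset.mem_insert_self c F) hℓ'
    (Finset.disjoint_insert_right.2 hF.2)
  simp only [Finset.mem_insert, not_or] at ho
  refine ⟨ℓ', .seq P (.count o c 0 P'), p + (.X * (p' + 3) + 3), fun n x s hn hx => ?_⟩
  simp only [Polynomial.eval_add, Polynomial.eval_mul, Polynomial.eval_X, Polynomial.eval_ofNat]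
  refine (hP n x s hn hx).seq fun s₁ ⟨hs₁, hy⟩ => ?_
  refine Runs.count (F := F ∪ Data.supp ℓ') (fun i s' => AgreeOn F s s' ∧
    Data.Rep ℓ' s' (((List.finRange n).drop i).foldr (f n x) (b n x)))
    (fun i s₁ s₂ h => And.imp (fun h' => h'.trans (h.mono Finset.subset_union_left))
      (Data.rep_congr (h.mono Finset.subset_union_right))) (by simp [ho, hF]) (by simp [hc, hF])
    ho.1 (ne_of_mem_of_not_mem h0 hc) ((hs₁.reg h0).trans hn) ⟨hs₁, ?_⟩ ?_
  · rwa [List.drop_of_length_le (by simp)]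
  · rintro i hi s₂ ⟨hs₂, hz⟩ hci
    rw [List.drop_eq_getElem_cons (by simpa using hi), List.foldr_cons, List.getElem_finRange]
    exact (hP' n x _ ⟨i, hi⟩ s₂ ((hs₂.reg h0).trans hn) (Data.rep_congr (hs₂.mono hℓ) hx) hz
      hci).mono le_rfl fun s₃ ⟨hs₃, hz'⟩ => ⟨⟨hs₂.trans (hs₃.mono (Finset.subset_insert c F)), hz'⟩,
        (hs₃.reg (Finset.mem_insert_self c F)).trans hci⟩

protected theorem not {φ : ∀ n, Γ n → Prop} (hφ : PolyTime φ) : PolyTime fun n x => ¬ φ n x := by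
  convert hφ.ite (dec := fun _ _ => Classical.dec _) (.const (p := False)) (.const (p := True))
    using 3
  split_ifs <;> simpa

protected theorem and {φ ψ : ∀ n, Γ n → Prop} (hφ : PolyTime φ) (hψ : PolyTime ψ) :
    PolyTime fun n x => φ n x ∧ ψ n x := by
  convert hφ.ite (dec := fun _ _ => Classical.dec _) hψ (.const (p := False)) using 3
  split_ifs <;> simp [*]

protected theorem or {φ ψ : ∀ n, Γ n → Prop} (hφ : PolyTime φ) (hψ : PolyTime ψ) :
    PolyTime fun n x => φ n x ∨ ψ n x := by
  simpa only [not_and_or, not_not] using (hφ.not.and hψ.not).not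

theorem exists_fin {φ : ∀ n, Γ n → Fin n → Prop} (hφ : PolyTime₂ φ) :
    PolyTime fun n x => ∃ i, φ n x i := by
  have hfold (n : ℕ) (x : Γ n) (L : List (Fin n)) :
      (L.foldr (fun i p => φ n x i ∨ p) False) = ∃ i ∈ L, φ n x i := by
    induction L with
    | nil => simp
    | cons i L ih => simp [ih]
  have hstep : PolyTime fun n (x : (Γ n × Prop) × Fin n) => φ n x.1.1 x.2 ∨ x.1.2 :=
    (hφ.comp (prodMk PolyTime.id.fst.fst PolyTime.id.snd)).or PolyTime.id.fst.snd
  simpa only [hfold, List.mem_finRange, true_and] using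
    foldr (f := fun n x i p => φ n x i ∨ p) hstep (.const (p := False))

theorem forall_fin {φ : ∀ n, Γ n → Fin n → Prop} (hφ : PolyTime₂ φ) :
    PolyTime fun n x => ∀ i, φ n x i := by
  simpa only [not_exists, not_not] using
    (exists_fin (φ := fun n x i => ¬ φ n x i) hφ.not).not

theorem iterate [Storable Δ] {f : ∀ n, Γ n → Δ n → Δ n} {b : ∀ n, Γ n → Δ n}
    (hf : PolyTime₂ f) (hb : PolyTime b) :
    PolyTime fun n x => (f n x)^[n] (b n x) := by
  simpa only [List.foldr_const, List.length_finRange] using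
    foldr (f := fun n x _ => f n x) (hf.comp PolyTime.id.fst) hb

theorem exists_program {f : ∀ n, SimpleGraph (Fin n) → Fin n → Fin n} (hf : PolyTime f) :
    ∃ (A : Program) (p : Polynomial ℕ), ∀ (n : ℕ) (G : SimpleGraph (Fin n)),
      Runs A (graphInput G) (p.eval n) fun s => ∀ v, s.colour v = f n G v := by
  obtain ⟨⟨b, x⟩, hℓ, hF⟩ := Storable.exists_isTarget (Δ := fun n => Fin n → Fin n) {0, 1, 2, 3}
  obtain ⟨P, p, hP⟩ := hf.realizes (F := {0, 2, 3}) (ℓ := (0, 2)) hℓ (by simp)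
    (by simp [Data.supp]) (hF.mono_right (by simp))
  simp only [Data.supp, Finset.disjoint_insert_left, Finset.disjoint_singleton_left,
    Finset.mem_insert, Finset.mem_singleton, not_or] at hF
  obtain ⟨P', p', hP'⟩ := exists_runs_copy_table 1 (F := {0, 3, b, x}) (a := 1) (b := b) (x := x)
    (y := 3) (by simp) (by simp) (by simp) (by simp) (by simp [Ne.symm hF.1.2.1, Ne.symm hF.2.2.1])
  refine ⟨.seq P P', p + p', fun n G => ?_⟩
  rw [Polynomial.eval_add]
  refine (hP n G (graphInput G) rfl (rep_graphInput G)).seq fun s₁ ⟨hs₁, hf₁⟩ => ?_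
  refine (hP' n s₁ (hs₁.reg (by simp))).mono le_rfl fun s₂ ⟨_, hs₂, _⟩ v => ?_
  have h3 : s₁.reg 3 = 0 := hs₁.reg (by simp)
  simp only [h3, pow_one, zero_mul, zero_add] at hs₂
  exact (hs₂ v v.isLt).trans (hf₁ v)

end PolyTime

end Ram

/-! ## Alternating forests and blossoms -/

namespace Matching

open Function Set

variable {V : Type*} {H : SimpleGraph V}

/-- A matching of `H`, encoded as an involution whose fixed points are the unmatched vertices. -/
structure IsMatch (H : SimpleGraph V) (f : V → V) : Prop where
  invol : Involutive f
  adj : ∀ x, f x ≠ x → H.Adj x (f x)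

/-- `s` is a vertex of `S` that `f` does not match with another vertex of `S`. -/
def Out (f : V → V) (S : Set V) (s : V) : Prop := s ∈ S ∧ (f s = s ∨ f s ∉ S)

theorem Out.mono {f : V → V} {S T : Set V} {s : V} (h : Out f T s) (hST : S ⊆ T) (hs : s ∈ S) :
    Out f S s :=
  ⟨hs, h.2.imp_right fun hfs hfs' => hfs (hST hfs')⟩

theorem ne_and_mem_of_not_out {f : V → V} {S : Set V} {s : V} (hs : s ∈ S) (h : ¬ Out f S s) :
    f s ≠ s ∧ f s ∈ S := by
  simpa [Out, hs] using h

theorem even_ncard_of_involutive {f : V → V} (hf : Involutive f) {S : Set V} (hS : S.Finite)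
    (h : ∀ x ∈ S, f x ≠ x ∧ f x ∈ S) : Even S.ncard := by
  have sum_eq := Finset.sum_involution (s := hS.toFinset) (f := fun _ => (1 : ZMod 2))
    (fun x _ => f x) (fun _ _ => by decide) (fun x hx _ => (h x (by simpa using hx)).1)
    (fun x hx => by simpa using (h x (by simpa using hx)).2) (fun x _ => hf x)
  rw [Finset.sum_const, nsmul_one] at sum_eq
  rw [ncard_eq_toFinset_card S hS]
  exact ZMod.natCast_eq_zero_iff_even.1 sum_eq

theorem odd_ncard_of_existsUnique_out {f : V → V} (hf : Involutive f) {S : Set V} (hS : S.Finite)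
    (h : ∃! s, Out f S s) : Odd S.ncard := by
  obtain ⟨s, hs, hs_unique⟩ := h
  have even_rest : Even (S \ {s}).ncard := by
    refine even_ncard_of_involutive hf hS.sdiff fun x ⟨hxS, hxs⟩ => ?_
    obtain ⟨hx, hfx⟩ := ne_and_mem_of_not_out hxS fun ho => hxs (hs_unique x ho)
    refine ⟨hx, hfx, fun hfxs : f x = s => ?_⟩
    have hfs : f s = x := by rw [← hfxs, hf]
    rcases hs.2 with h | h
    · exact hxs (hfs.symm.trans h)
    · exact h (hfs ▸ hxS)
  rw [← ncard_sdiff_singleton_add_one hs.1 hS]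
  exact even_rest.add_one

/-- `cl` is an equivalence relation on the set `D` of outer vertices of an alternating forest, which
is disjoint from the set `I` of inner vertices. -/
structure IsPartition (D I : Set V) (cl : V → V → Prop) : Prop where
  disj : ∀ w ∈ I, w ∉ D
  refl : ∀ k ∈ D, cl k k
  symm : ∀ k l, cl k l → cl l k
  trans : ∀ k l m, cl k l → cl l m → cl k m
  mem_left : ∀ k l, cl k l → k ∈ D

theorem IsPartition.mem_right {D I : Set V} {cl : V → V → Prop} (h : IsPartition D I cl) {k l : V}
    (hkl : cl k l) : l ∈ D :=
  h.mem_left _ _ (h.symm _ _ hkl)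

/-- `f` is a matching with `d` unmatched vertices, among them the outer vertex `x`, that is obtained
by an exchange along an alternating forest with outer vertices `D`, inner vertices `I` and blossoms
`{l | cl k l}`: every blossom has exactly one vertex that `f` does not match within it, and that one
is unmatched or matched with an inner vertex. -/
structure IsRooted (H : SimpleGraph V) (d : ℕ) (D I : Set V) (cl : V → V → Prop) (x : V)
    (f : V → V) : Prop extends IsMatch H f where
  self : f x = x
  size : (fixedPoints f).ncard = d
  fixed_mem : ∀ y, f y = y → y ∈ D
  inner : ∀ w ∈ I, f w ∈ D
  outer : ∀ k ∈ D, f k ∈ I ∨ cl k (f k)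
  out : ∀ k ∈ D, ∃! s, Out f {l | cl k l} s

/-- An alternating forest with outer vertices `D`, inner vertices `I` and blossoms `{l | cl k l}`.
Instead of the trees it records, for every outer vertex `x`, the matching `N x` that results from an
exchange along an alternating path from a root to `x`. An inner vertex is matched either with its
parent or with its child in all of them. -/
structure IsForest (H : SimpleGraph V) (d : ℕ) (D I : Set V) (cl : V → V → Prop)
    (N : V → V → V) : Prop extends IsPartition D I cl where
  rooted : ∀ x ∈ D, IsRooted H d D I cl x (N x)
  rest : ∀ x ∈ D, ∀ y ∈ D, ∀ r, r ∉ D → r ∉ I → N x r = N y r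
  two_mates : ∀ w ∈ I, ∃ a b, ∀ x ∈ D, N x w = a ∨ N x w = b

theorem isForest_initial {f : V → V} (hf : IsMatch H f) :
    IsForest H (fixedPoints f).ncard (fixedPoints f) ∅ (fun x y => x = y ∧ x ∈ fixedPoints f)
      (fun _ => f) where
  disj _ h := h.elim
  refl _ hk := ⟨rfl, hk⟩
  symm := by rintro k l ⟨rfl, h⟩; exact ⟨rfl, h⟩
  trans := by rintro k l m ⟨rfl, h⟩ ⟨rfl, -⟩; exact ⟨rfl, h⟩
  mem_left _ _ h := h.2
  rooted x hx :=
    { hf with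
      self := hx
      size := rfl
      fixed_mem := fun _ hy => hy
      inner := fun _ h => h.elim
      outer := fun _ hk => .inr ⟨Eq.symm hk, hk⟩
      out := fun k hk => ⟨k, ⟨⟨rfl, hk⟩, .inl hk⟩, fun _ h => h.1.1.symm⟩ }
  rest _ _ _ _ _ _ _ := rfl
  two_mates _ h := h.elim

section stuck

variable [Finite V] {d : ℕ} {D I : Set V} {cl : V → V → Prop} {N : V → V → V}

theorem IsForest.exists_cl_fixed_or_inner (h : IsForest H d D I cl N)
    (hstuck : ∀ v ∈ D, ∀ u, H.Adj v u → u ∈ I ∨ cl v u) {g : V → V} (hg : IsMatch H g) {k : V}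
    (hk : k ∈ D) : ∃ l, cl k l ∧ (g l = l ∨ g l ∈ I) := by
  by_contra! hno
  have odd := odd_ncard_of_existsUnique_out (h.rooted k hk).invol (toFinite _)
    ((h.rooted k hk).out k hk)
  refine Nat.not_even_iff_odd.2 odd (even_ncard_of_involutive hg.invol (toFinite _) fun l hl => ?_)
  obtain ⟨hgl, hglI⟩ := hno l hl
  refine ⟨hgl, h.trans _ _ _ hl ?_⟩
  exact (hstuck l (h.mem_right hl) _ (hg.adj l hgl)).resolve_left hglI

/-- Both sides count the blossoms: the unmatched vertices of `f` and its partners of inner vertices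
are the vertices that `f` does not match within their blossom. -/
theorem IsForest.ncard_add_ncard_le_ncard_out (h : IsForest H d D I cl N) {x : V} {f : V → V}
    (hf : IsRooted H d D I cl x f) :
    d + I.ncard ≤ {k | k ∈ D ∧ Out f {l | cl k l} k}.ncard := by
  have disjoint : Disjoint (fixedPoints f) (f '' I) := by
    refine disjoint_left.2 fun y (hy : f y = y) ⟨w, hw, hwy⟩ => ?_
    have hyw : y = w := by rw [← hf.invol w, hwy, hy]
    exact h.disj w hw (hyw ▸ hf.fixed_mem y hy)
  rw [← hf.size, ← ncard_image_of_injective I hf.invol.injective, ← ncard_union_eq disjoint]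
  refine ncard_le_ncard ?_ (toFinite _)
  rintro _ (hy | ⟨w, hw, rfl⟩)
  · exact ⟨hf.fixed_mem _ hy, h.refl _ (hf.fixed_mem _ hy), .inl hy⟩
  · refine ⟨hf.inner w hw, h.refl _ (hf.inner w hw), .inr fun hcl => h.disj w hw ?_⟩
    have := h.mem_right hcl
    rwa [hf.invol] at this

theorem IsForest.le_ncard_fixedPoints (h : IsForest H d D I cl N) (hD : D.Nonempty)
    (hstuck : ∀ v ∈ D, ∀ u, H.Adj v u → u ∈ I ∨ cl v u) {g : V → V} (hg : IsMatch H g) :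
    d ≤ (fixedPoints g).ncard := by
  obtain ⟨x, hx⟩ := hD
  have : Nonempty V := ⟨x⟩
  choose! q hcl hq using fun k (hk : k ∈ D) => h.exists_cl_fixed_or_inner hstuck hg hk
  have le_add : {k | k ∈ D ∧ Out (N x) {l | cl k l} k}.ncard ≤ (fixedPoints g ∪ I).ncard := by
    refine ncard_le_ncard_of_injOn (fun k => g (q k)) ?_ ?_ (toFinite _)
    · rintro k ⟨hk, -⟩
      exact (hq k hk).imp_left fun hfix => show g (g (q k)) = g (q k) by rw [hfix, hfix]
    · rintro k ⟨hk, hok⟩ l ⟨hl, hol⟩ hkl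
      have hqkl : q k = q l := hg.invol.injective hkl
      have hkl : cl k l := h.trans _ _ _ (hcl k hk) (hqkl ▸ h.symm _ _ (hcl l hl))
      refine ((h.rooted x hx).out k hk).unique hok (hol.mono ?_ hkl)
      exact fun m hm => h.trans _ _ _ (h.symm _ _ hkl) hm
  have add_le := h.ncard_add_ncard_le_ncard_out (h.rooted x hx)
  have union_le := ncard_union_le (fixedPoints g) I
  omega

end stuck

open Classical in
/-- The exchange of `g` that matches `u ∈ S` with `v ∉ S`, the other vertices of `S` as `f` does,
and the other vertices outside `S` as `g` does, unless their partners lie in `S`. -/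
noncomputable def mix (S : Set V) (u v : V) (f g : V → V) (y : V) : V :=
  if y = u then v else if y = v then u else if y ∈ S then f y else if g y ∈ S then y else g y

section mix

variable {S : Set V} {u v y : V} {f g : V → V}

@[simp] theorem mix_left : mix S u v f g u = v := by simp [mix]

theorem mix_right (huv : u ≠ v) : mix S u v f g v = u := by simp [mix, huv.symm]

theorem mix_of_mem (hv : v ∉ S) (hy : y ∈ S) (hyu : y ≠ u) : mix S u v f g y = f y := by
  have hyv : y ≠ v := fun h => hv (h ▸ hy)
  simp [mix, hyv, hy, hyu]

theorem mix_of_apply_mem (hu : u ∈ S) (hy : y ∉ S) (hyv : y ≠ v) (hg : g y ∈ S) :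
    mix S u v f g y = y := by
  have hyu : y ≠ u := fun h => hy (h ▸ hu)
  simp [mix, hyu, hy, hyv, hg]

theorem mix_of_apply_notMem (hu : u ∈ S) (hy : y ∉ S) (hyv : y ≠ v) (hg : g y ∉ S) :
    mix S u v f g y = g y := by
  have hyu : y ≠ u := fun h => hy (h ▸ hu)
  simp [mix, hyu, hy, hyv, hg]

theorem mix_cases (S : Set V) (u v : V) (g : V → V) (y : V) :
    y = u ∨ y = v ∨ (y ∈ S ∧ y ≠ u) ∨ (y ∉ S ∧ y ≠ v ∧ g y ∈ S) ∨ (y ∉ S ∧ y ≠ v ∧ g y ∉ S) := by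
  tauto

theorem isMatch_mix (hf : IsMatch H f) (hg : IsMatch H g) (hu : u ∈ S) (hv : v ∉ S)
    (huv : H.Adj v u) (hgv : g v = v) (hS : ∀ y ∈ S, y ≠ u → f y ∈ S ∧ f y ≠ u) :
    IsMatch H (mix S u v f g) := by
  have hne : u ≠ v := huv.ne'
  refine ⟨fun y => ?_, fun y => ?_⟩
  · rcases mix_cases S u v g y with rfl | rfl | ⟨hy, hyu⟩ | ⟨hy, hyv, hgy⟩ | ⟨hy, hyv, hgy⟩
    · rw [mix_left, mix_right hne]
    · rw [mix_right hne, mix_left]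
    · rw [mix_of_mem hv hy hyu, mix_of_mem hv (hS y hy hyu).1 (hS y hy hyu).2, hf.invol]
    · rw [mix_of_apply_mem hu hy hyv hgy, mix_of_apply_mem hu hy hyv hgy]
    · have hgyv : g y ≠ v := fun h => hyv (by rw [← hg.invol y, h, hgv])
      rw [mix_of_apply_notMem hu hy hyv hgy,
        mix_of_apply_notMem hu hgy hgyv (by rwa [hg.invol]), hg.invol]
  · rcases mix_cases S u v g y with rfl | rfl | ⟨hy, hyu⟩ | ⟨hy, hyv, hgy⟩ | ⟨hy, hyv, hgy⟩
    · rw [mix_left]; exact fun _ => huv.symm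
    · rw [mix_right hne]; exact fun _ => huv
    · rw [mix_of_mem hv hy hyu]; exact hf.adj y
    · rw [mix_of_apply_mem hu hy hyv hgy]; exact fun h => absurd rfl h
    · rw [mix_of_apply_notMem hu hy hyv hgy]; exact hg.adj y

theorem fixedPoints_mix (hu : u ∈ S) (hv : v ∉ S) (hS : ∀ y ∈ S, y ≠ u → f y ≠ y) :
    fixedPoints (mix S u v f g) = {y | y ∉ S ∧ y ≠ v ∧ (g y ∈ S ∨ g y = y)} := by
  have hne : u ≠ v := fun h => hv (h ▸ hu)
  ext y
  simp only [mem_fixedPoints_iff, mem_ofPred_eq]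
  rcases mix_cases S u v g y with rfl | rfl | ⟨hy, hyu⟩ | ⟨hy, hyv, hgy⟩ | ⟨hy, hyv, hgy⟩
  · rw [mix_left]; simp [hne.symm, hu]
  · rw [mix_right hne]; simp [hne]
  · rw [mix_of_mem hv hy hyu]; simp [hS y hy hyu, hy]
  · rw [mix_of_apply_mem hu hy hyv hgy]; simp [*]
  · rw [mix_of_apply_notMem hu hy hyv hgy]; simp [*]

theorem ncard_fixedPoints_mix [Finite V] (hg : Involutive g) (hu : u ∈ S) (hv : v ∉ S)
    (hgv : g v = v) (hS : ∀ y ∈ S, y ≠ u → f y ≠ y) (hout : ∃! s, Out g S s) {w : V} (hw : w ∉ S)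
    (hgw : g w ∈ S) : (fixedPoints (mix S u v f g)).ncard = (fixedPoints g).ncard := by
  have out_gw : Out g S (g w) := ⟨hgw, .inr (by rwa [hg])⟩
  have hwg : g w ≠ w := fun h => hw (h ▸ hgw)
  have eq_insert : fixedPoints (mix S u v f g) = insert w (fixedPoints g \ {v}) := by
    rw [fixedPoints_mix hu hv hS]
    ext y
    simp only [mem_ofPred_eq, mem_insert_iff, mem_sdiff, mem_fixedPoints_iff, mem_singleton_iff]
    constructor
    · rintro ⟨hy, hyv, hgy | hgy⟩
      · exact .inl (hg.injective (hout.unique ⟨hgy, .inr (by rwa [hg])⟩ out_gw))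
      · exact .inr ⟨hgy, hyv⟩
    · rintro (rfl | ⟨hgy, hyv⟩)
      · exact ⟨hw, fun hyv => hwg (hyv ▸ hgv), .inl hgw⟩
      · refine ⟨fun hy => hwg ?_, hyv, .inr hgy⟩
        have hgwy : g w = y := hout.unique out_gw ⟨hy, .inl hgy⟩
        rw [← hg w, hgwy, hgy, hgy]
  rw [eq_insert, ncard_insert_of_notMem (fun h => hwg h.1) (toFinite _),
    ncard_sdiff_singleton_add_one (show v ∈ fixedPoints g from hgv) (toFinite _)]

theorem ncard_fixedPoints_mix_lt [Finite V] (hu : u ∈ S) (hv : v ∉ S) (hgv : g v = v)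
    (hS : ∀ y ∈ S, y ≠ u → f y ≠ y) (hclosed : ∀ w, w ∉ S → g w ∉ S) :
    (fixedPoints (mix S u v f g)).ncard < (fixedPoints g).ncard := by
  refine ncard_lt_ncard ?_ (toFinite _)
  rw [fixedPoints_mix hu hv hS]
  refine ⟨fun y hy => ?_, fun hss => (hss (show v ∈ fixedPoints g from hgv)).2.1 rfl⟩
  exact hy.2.2.resolve_left (hclosed y hy.1)

end mix

theorem existsUnique_out_union {f : V → V} (hf : Involutive f) {A B : Set V} {w : V}
    (hAB : Disjoint A B) (hwA : w ∉ A) (hwB : w ∉ B) (hfw : f w ∈ A) (hA : ∃! s, Out f A s)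
    (hB : ∃! s, Out f B s) : ∃! s, Out f (A ∪ {w} ∪ B) s := by
  obtain ⟨k, hk, hk_unique⟩ := hB
  have out_fw : Out f A (f w) := ⟨hfw, .inr (by rwa [hf])⟩
  have hkA : k ∉ A := fun hkA => disjoint_left.1 hAB hkA hk.1
  refine ⟨k, ⟨.inr hk.1, hk.2.imp_right ?_⟩, fun t ht => ?_⟩
  · rintro hfkB ((hfkA | hfkw) | hfkB')
    · have hwk : f w = f k := hA.unique out_fw ⟨hfkA, .inr (by rwa [hf])⟩
      exact hwB (hf.injective hwk ▸ hk.1)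
    · exact hkA (by rw [← hf k, show f k = w from hfkw]; exact hfw)
    · exact hfkB hfkB'
  · rcases ht.1 with (htA | rfl) | htB
    · have ht_eq : t = f w := hA.unique (ht.mono (fun a ha => .inl (.inl ha)) htA) out_fw
      rw [ht_eq, Out, hf] at ht
      rcases ht.2 with hwf | hwS
      · exact absurd (hwf ▸ hfw) hwA
      · exact absurd (.inl (.inr rfl)) hwS
    · rcases ht.2 with hfix | hftS
      · exact absurd (hfix ▸ hfw) hwA
      · exact absurd (.inl (.inl hfw)) hftS
    · exact hk_unique t (ht.mono (fun b hb => .inr hb) htB)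

section grow

variable {d : ℕ} {D I : Set V} {cl : V → V → Prop} {N : V → V → V} {f : V → V} {u v r x k : V}

theorem IsRooted.apply_notMem (h : IsPartition D I cl) (hf : IsRooted H d D I cl x f)
    (huD : u ∉ D) (huI : u ∉ I) : f u ∉ D ∧ f u ∉ I ∧ f u ≠ u := by
  refine ⟨fun hfu => ?_, fun hfu => huD ?_, fun hfu => huD (hf.fixed_mem u hfu)⟩
  · have hcl := hf.outer _ hfu
    rw [hf.invol] at hcl
    exact hcl.elim huI fun hcl => huD (h.mem_right hcl)
  · rw [← hf.invol u]
    exact hf.inner _ hfu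

theorem IsPartition.grow (h : IsPartition D I cl) (huD : u ∉ D) (hrD : r ∉ D) (hrI : r ∉ I)
    (hru : r ≠ u) :
    IsPartition (D ∪ {r}) (I ∪ {u}) (fun k l => cl k l ∨ (k = r ∧ l = r)) where
  disj := by
    rintro w (hw | rfl) (hwD | rfl)
    exacts [h.disj w hw hwD, hrI hw, huD hwD, hru rfl]
  refl := by
    rintro k (hk | rfl)
    exacts [.inl (h.refl k hk), .inr ⟨rfl, rfl⟩]
  symm k l hkl := hkl.imp (h.symm k l) And.symm
  trans := by
    rintro k l m (hkl | ⟨rfl, rfl⟩) (hlm | ⟨hlr, rfl⟩)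
    · exact .inl (h.trans _ _ _ hkl hlm)
    · exact absurd (hlr ▸ h.mem_right hkl) hrD
    · exact absurd (h.mem_left _ _ hlm) hrD
    · exact .inr ⟨rfl, rfl⟩
  mem_left k l hkl := hkl.imp (h.mem_left k l) And.left

theorem class_grow_of_mem (hrD : r ∉ D) (hk : k ∈ D) :
    {l | cl k l ∨ (k = r ∧ l = r)} = {l | cl k l} := by
  ext l
  simp [show k ≠ r from fun hkr => hrD (hkr ▸ hk)]

theorem IsPartition.class_grow_self (h : IsPartition D I cl) (hrD : r ∉ D) :
    {l | cl r l ∨ (r = r ∧ l = r)} = {r} := by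
  ext l
  simp [show ¬ cl r l from fun hl => hrD (h.mem_left _ _ hl)]

theorem IsRooted.grow (h : IsPartition D I cl) (hf : IsRooted H d D I cl x f)
    (huD : u ∉ D) (huI : u ∉ I) :
    IsRooted H d (D ∪ {f u}) (I ∪ {u}) (fun k l => cl k l ∨ (k = f u ∧ l = f u)) x f where
  toIsMatch := hf.toIsMatch
  self := hf.self
  size := hf.size
  fixed_mem y hy := .inl (hf.fixed_mem y hy)
  inner := by
    rintro w (hw | rfl)
    exacts [.inl (hf.inner w hw), .inr rfl]
  outer := by
    rintro k (hk | rfl)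
    · exact (hf.outer k hk).imp .inl .inl
    · exact .inl (.inr (hf.invol u))
  out := by
    obtain ⟨hrD, -, hru⟩ := hf.apply_notMem h huD huI
    rintro k (hk | rfl)
    · rw [class_grow_of_mem hrD hk]
      exact hf.out k hk
    · rw [h.class_grow_self hrD]
      refine ⟨f u, ⟨rfl, .inr ?_⟩, fun s hs => hs.1⟩
      rw [hf.invol]
      exact hru.symm

theorem mix_singleton (hf : Involutive f) (hfv : f v = v) (hvu : v ≠ u) (hfu : f u ≠ u) :
    mix {u} u v f f v = u ∧ mix {u} u v f f (f u) = f u ∧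
      ∀ y, y ≠ u → y ≠ v → y ≠ f u → mix {u} u v f f y = f y := by
  have hfuv : f u ≠ v := fun h => hvu (by rw [← hfv, ← h, hf])
  refine ⟨mix_right hvu.symm, mix_of_apply_mem rfl hfu hfuv (hf u), fun y hyu hyv hyfu => ?_⟩
  exact mix_of_apply_notMem rfl hyu hyv fun hfy : f y = u => hyfu (by rw [← hfy, hf])

/-- An exchange along the edge `v u` and the matching edge of `u` keeps the set of outer vertices
that are not matched within their blossom. -/
theorem IsRooted.reroot [Finite V] (h : IsPartition D I cl) (hf : IsRooted H d D I cl v f)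
    (hu : u ∈ I) (huv : H.Adj v u) : IsRooted H d D I cl (f u) (mix {u} u v f f) := by
  have hvu : v ∉ ({u} : Set V) := huv.ne
  have hv : v ∈ D := hf.fixed_mem v hf.self
  have huD : u ∉ D := h.disj u hu
  have hrD : f u ∈ D := hf.inner u hu
  have hru : f u ≠ u := fun hfu => huD (hfu ▸ hrD)
  obtain ⟨apply_v, apply_r, apply_of_ne⟩ := mix_singleton hf.invol hf.self huv.ne hru
  have vacuous {p : V → Prop} : ∀ y ∈ ({u} : Set V), y ≠ u → p y := fun y hy hyu => absurd hy hyu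
  have hout : ∃! s, Out f {u} s := ⟨u, ⟨rfl, .inr hru⟩, fun s hs => hs.1⟩
  refine ⟨isMatch_mix hf.toIsMatch hf.toIsMatch rfl hvu huv hf.self vacuous, apply_r, ?_,
    fun y hy => ?_, fun w hw => ?_, fun k hk => ?_, fun k hk => ?_⟩
  · rw [ncard_fixedPoints_mix hf.invol (mem_singleton u) hvu hf.self vacuous hout hru
      (hf.invol u), hf.size]
  · have hy' : y ∈ fixedPoints (mix {u} u v f f) := hy
    rw [fixedPoints_mix (mem_singleton u) hvu vacuous] at hy'
    rcases hy'.2.2 with hfy | hfy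
    · rwa [← hf.invol y, show f y = u from hfy]
    · exact hf.fixed_mem y hfy
  · by_cases hwu : w = u
    · rw [hwu, mix_left]; exact hv
    · have hwD := h.disj w hw
      rw [apply_of_ne w hwu (fun hwv => hwD (hwv ▸ hv)) (fun hwr => hwD (hwr ▸ hrD))]
      exact hf.inner w hw
  · by_cases hkv : k = v
    · rw [hkv, apply_v]; exact .inl hu
    by_cases hkr : k = f u
    · rw [hkr, apply_r]; exact .inr (h.refl _ hrD)
    rw [apply_of_ne k (fun hku => huD (hku ▸ hk)) hkv hkr]
    exact hf.outer k hk
  · have out_iff : ∀ s, Out (mix {u} u v f f) {l | cl k l} s ↔ Out f {l | cl k l} s := by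
      refine fun s => and_congr_right fun hs => ?_
      have huK : u ∉ {l | cl k l} := fun hku => huD (h.mem_right hku)
      by_cases hsv : s = v
      · rw [hsv, apply_v, hf.self]; simp [huK]
      by_cases hsr : s = f u
      · rw [hsr, apply_r, hf.invol]; simp [huK]
      rw [apply_of_ne s (fun hsu => huK (hsu ▸ hs)) hsv hsr]
    simpa only [out_iff] using hf.out k hk

theorem IsForest.grow [Finite V] (h : IsForest H d D I cl N) (hv : v ∈ D) (huv : H.Adj v u)
    (huD : u ∉ D) (huI : u ∉ I) {N' : V → V → V} (hN : ∀ x ∈ D, N' x = N x)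
    (hN' : N' (N v u) = mix {u} u v (N v) (N v)) :
    IsForest H d (D ∪ {N v u}) (I ∪ {u}) (fun k l => cl k l ∨ (k = N v u ∧ l = N v u)) N' := by
  have hroot := h.rooted v hv
  obtain ⟨hrD, hrI, hru⟩ := hroot.apply_notMem h.toIsPartition huD huI
  have eq_r : ∀ x ∈ D, N x u = N v u := fun x hx => h.rest x hx v hv u huD huI
  have part := h.toIsPartition.grow huD hrD hrI hru
  have apply_of_ne := (mix_singleton hroot.invol hroot.self huv.ne hru).2.2
  rw [← hN'] at apply_of_ne
  have rooted : ∀ x ∈ D ∪ {N v u}, IsRooted H d (D ∪ {N v u}) (I ∪ {u})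
      (fun k l => cl k l ∨ (k = N v u ∧ l = N v u)) x (N' x) := by
    rintro x (hx | rfl)
    · rw [hN x hx, ← eq_r x hx]
      exact (h.rooted x hx).grow h.toIsPartition huD huI
    · rw [hN']
      exact (hroot.grow h.toIsPartition huD huI).reroot part (.inr rfl) huv
  have rest : ∀ x ∈ D ∪ {N v u}, ∀ y, y ∉ D ∪ {N v u} → y ∉ I ∪ {u} → N' x y = N v y := by
    rintro x (hx | rfl) y hyD hyI
    · rw [hN x hx]
      exact h.rest x hx v hv y (fun hy => hyD (.inl hy)) (fun hy => hyI (.inl hy))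
    · exact apply_of_ne y (fun hyu => hyI (.inr hyu)) (fun hyv => hyD (.inl (hyv ▸ hv)))
        (fun hyr => hyD (.inr hyr))
  refine { part with rooted := rooted, rest := fun x hx y hy z hz hz' => ?_, two_mates := ?_ }
  · rw [rest x hx z hz hz', rest y hy z hz hz']
  · rintro w (hw | rfl)
    · obtain ⟨a, b, hab⟩ := h.two_mates w hw
      refine ⟨a, b, ?_⟩
      rintro x (hx | rfl)
      · rw [hN x hx]; exact hab x hx
      · rw [apply_of_ne w (fun hwu => huI (hwu ▸ hw)) (fun hwv => h.disj w hw (hwv ▸ hv))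
          (fun hwr => hrI (hwr ▸ hw))]
        exact hab v hv
    · refine ⟨N v w, v, ?_⟩
      rintro x (hx | rfl)
      · rw [hN x hx]; exact .inl (eq_r x hx)
      · rw [hN', mix_left]; exact .inr rfl

end grow

section petal

variable {d : ℕ} {D I S T : Set V} {cl : V → V → Prop} {N N' : V → V → V} {g : V → V}
  {s u v w x : V}

/-- A union of blossoms and inner vertices that can be part of a larger blossom: the matchings of
the forest match all but one of its vertices, and all of its inner vertices, within it. -/
structure IsPetal (D I : Set V) (cl : V → V → Prop) (N : V → V → V) (S : Set V) : Prop where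
  sub : ∀ y ∈ S, y ∈ D ∨ y ∈ I
  sat : ∀ y z, y ∈ S → cl y z → z ∈ S
  inner : ∀ x ∈ D, ∀ w ∈ S, w ∈ I → N x w ∈ S
  out : ∀ x ∈ D, ∃! s, Out (N x) S s

theorem IsForest.isPetal_class (h : IsForest H d D I cl N) (hu : u ∈ D) :
    IsPetal D I cl N {l | cl u l} where
  sub _ hy := .inl (h.mem_right hy)
  sat _ _ hy hyz := h.trans _ _ _ hy hyz
  inner _ _ w hw hwI := absurd (h.mem_right hw) (h.disj w hwI)
  out x hx := (h.rooted x hx).out u hu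

theorem IsForest.eq_of_out (h : IsForest H d D I cl N) (hS : IsPetal D I cl N S) (hu : u ∈ D)
    (huS : u ∈ S) (hs : Out (N u) S s) : s = u :=
  (hS.out u hu).unique hs ⟨huS, .inl (h.rooted u hu).self⟩

theorem IsMatch.out_apply {f : V → V} (hf : IsMatch H f) (hw : w ∉ S) (hfw : f w ∈ S) :
    Out f S (f w) := ⟨hfw, .inr (by rwa [hf.invol])⟩

theorem IsForest.mem_inner_of_apply_mem (h : IsForest H d D I cl N) (hS : IsPetal D I cl N S)
    (hv : v ∈ D)
    (hw : w ∉ S) (hvw : N v w ∈ S) : w ∈ I := by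
  have hroot := h.rooted v hv
  rw [← hroot.invol w] at hw ⊢
  rcases hS.sub _ hvw with hD | hI
  · exact (hroot.outer _ hD).resolve_right fun hcl => hw (hS.sat _ _ hvw hcl)
  · exact absurd (hS.inner v hv _ hvw hI) hw

theorem IsForest.apply_notMem_of_mem (h : IsForest H d D I cl N) (hS : IsPetal D I cl N S)
    (hu : u ∈ D) (huS : u ∈ S) (hw : w ∉ S) : N u w ∉ S := fun huw => hw <| by
  have hroot := h.rooted u hu
  have huw_eq := h.eq_of_out hS hu huS (hroot.out_apply hw huw)
  rwa [← hroot.invol w, huw_eq, hroot.self]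

theorem IsForest.apply_eq_or_eq (h : IsForest H d D I cl N) (hw : w ∈ I) (hu : u ∈ D) (hv : v ∈ D)
    (hne : N v w ≠ N u w) (hx : x ∈ D) : N x w = N v w ∨ N x w = N u w := by
  obtain ⟨a, b, hab⟩ := h.two_mates w hw
  have := hab x hx
  have := hab u hu
  have := hab v hv
  grind

theorem IsForest.isPetal_extend (h : IsForest H d D I cl N) (hS : IsPetal D I cl N S) (hu : u ∈ D)
    (hv : v ∈ D) (huS : u ∈ S) (hw : w ∉ S) (hvw : N v w ∈ S) :
    IsPetal D I cl N (S ∪ {w} ∪ {l | cl (N u w) l}) := by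
  have hwI := h.mem_inner_of_apply_mem hS hv hw hvw
  have hwD := h.disj w hwI
  have huw : N u w ∈ D := (h.rooted u hu).inner w hwI
  have huwS := h.apply_notMem_of_mem hS hu huS hw
  have disjoint : Disjoint S {l | cl (N u w) l} :=
    disjoint_left.2 fun y hy hcl => huwS (hS.sat _ _ hy (h.symm _ _ hcl))
  have hwK : w ∉ {l | cl (N u w) l} := fun hcl => hwD (h.mem_right hcl)
  have mates : ∀ x ∈ D, N x w = N v w ∨ N x w = N u w := fun x hx =>
    h.apply_eq_or_eq hwI hu hv (fun he => huwS (he ▸ hvw)) hx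
  refine ⟨?_, ?_, ?_, fun x hx => ?_⟩
  · rintro y ((hy | rfl) | hy)
    exacts [hS.sub y hy, .inr hwI, .inl (h.mem_right hy)]
  · rintro y z ((hy | rfl) | hy) hyz
    · exact .inl (.inl (hS.sat _ _ hy hyz))
    · exact absurd (h.mem_left _ _ hyz) hwD
    · exact .inr (h.trans _ _ _ hy hyz)
  · rintro x hx y ((hy | rfl) | hy) hyI
    · exact .inl (.inl (hS.inner x hx y hy hyI))
    · rcases mates x hx with he | he <;> rw [he]
      exacts [.inl (.inl hvw), .inr (h.refl _ huw)]
    · exact absurd (h.mem_right hy) (h.disj y hyI)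
  · have hroot := h.rooted x hx
    rcases mates x hx with he | he
    · exact existsUnique_out_union hroot.invol disjoint hw hwK (he ▸ hvw) (hS.out x hx)
        (hroot.out _ huw)
    · have := existsUnique_out_union hroot.invol disjoint.symm hwK hw
        (by rw [he]; exact h.refl _ huw) (hroot.out _ huw) (hS.out x hx)
      rwa [union_right_comm, union_comm _ S, union_right_comm] at this

theorem IsForest.apply_mem_petal (h : IsForest H d D I cl N) (hS : IsPetal D I cl N S) (hu : u ∈ D)
    (huS : u ∈ S) (y : V) (hy : y ∈ S) (hyu : y ≠ u) :
    N u y ∈ S ∧ N u y ≠ u ∧ N u y ≠ y := by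
  obtain ⟨hne, hmem⟩ := ne_and_mem_of_not_out hy fun ho => hyu (h.eq_of_out hS hu huS ho)
  refine ⟨hmem, fun he => hyu ?_, hne⟩
  rw [← (h.rooted u hu).invol y, he, (h.rooted u hu).self]

/-- `g` is a matching with as many edges as `f` that agrees with `f` outside `S` and matches all
vertices of `S` other than `w` within `S`. -/
structure IsRerooted (H : SimpleGraph V) (f : V → V) (S : Set V) (w : V) (g : V → V) : Prop
    extends IsMatch H g where
  self : g w = w
  size : (fixedPoints g).ncard = (fixedPoints f).ncard
  eq_of_notMem : ∀ y, y ∉ S → g y = f y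
  mapsTo : ∀ y ∈ S, g y ∈ S
  eq_of_fixed : ∀ y ∈ S, g y = y → y = w

theorem IsForest.isRerooted_mix [Finite V] (h : IsForest H d D I cl N) (hS : IsPetal D I cl N S)
    (hu : u ∈ D) (hv : v ∈ D) (hvS : v ∈ S) (huv : H.Adj v u) (hT : IsPetal D I cl N T)
    (huT : u ∈ T) (hvT : v ∉ T) (hTS : T ⊆ S) (hw : w ∉ T) (hwS : w ∈ S) (hvw : N v w ∈ T) :
    IsRerooted H (N v) S w (mix T u v (N u) (N v)) := by
  have hroot := h.rooted v hv
  have hpet := h.apply_mem_petal hT hu huT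
  have hne : u ≠ v := huv.ne'
  have hwv : w ≠ v := fun he => hvT (by rwa [he, hroot.self] at hvw)
  have eq_w : ∀ y, y ∉ T → N v y ∈ T → y = w := fun y hy hvy => hroot.invol.injective <|
    (hT.out v hv).unique (hroot.out_apply hy hvy) (hroot.out_apply hw hvw)
  refine ⟨?_, mix_of_apply_mem huT hw hwv hvw, ?_, fun y hy => ?_, fun y hy => ?_,
    fun y hy hfix => ?_⟩
  · exact isMatch_mix (h.rooted u hu).toIsMatch hroot.toIsMatch huT hvT huv hroot.self
      fun y hy hyu => ⟨(hpet y hy hyu).1, (hpet y hy hyu).2.1⟩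
  · exact ncard_fixedPoints_mix hroot.invol huT hvT hroot.self
      (fun y hy hyu => (hpet y hy hyu).2.2) (hT.out v hv) hw hvw
  · have hyT : y ∉ T := fun hyT => hy (hTS hyT)
    refine mix_of_apply_notMem huT hyT (fun hyv => hy (hyv ▸ hvS)) fun hvy => ?_
    exact hy (eq_w y hyT hvy ▸ hwS)
  · rcases mix_cases T u v (N v) y with rfl | rfl | ⟨hyT, hyu⟩ | ⟨hyT, hyv, hvy⟩ | ⟨hyT, hyv, hvy⟩
    · rw [mix_left]; exact hvS
    · rw [mix_right hne]; exact hTS huT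
    · rw [mix_of_mem hvT hyT hyu]; exact hTS (hpet y hyT hyu).1
    · rw [mix_of_apply_mem huT hyT hyv hvy]; exact hy
    · rw [mix_of_apply_notMem huT hyT hyv hvy]
      exact (h.apply_mem_petal hS hv hvS y hy hyv).1
  · rw [← mem_fixedPoints_iff, fixedPoints_mix huT hvT fun y hy hyu => (hpet y hy hyu).2.2] at hfix
    obtain ⟨hyT, hyv, hvy | hvy⟩ := hfix
    · exact eq_w y hyT hvy
    · exact absurd hvy (h.apply_mem_petal hS hv hvS y hy hyv).2.2

theorem IsPartition.shrink (h : IsPartition D I cl) (hsat : ∀ y z, y ∈ S → cl y z → z ∈ S) :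
    IsPartition (D ∪ S) (I \ S) (fun k l => cl k l ∨ (k ∈ S ∧ l ∈ S)) where
  disj w hw hwDS := hwDS.elim (h.disj w hw.1) hw.2
  refl := by
    rintro k (hk | hk)
    exacts [.inl (h.refl k hk), .inr ⟨hk, hk⟩]
  symm k l hkl := hkl.imp (h.symm k l) And.symm
  trans := by
    rintro k l m (hkl | ⟨hk, hl⟩) (hlm | ⟨hl', hm⟩)
    · exact .inl (h.trans _ _ _ hkl hlm)
    · exact .inr ⟨hsat _ _ hl' (h.symm _ _ hkl), hm⟩
    · exact .inr ⟨hk, hsat _ _ hl hlm⟩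
    · exact .inr ⟨hk, hm⟩
  mem_left k l hkl := hkl.imp (h.mem_left k l) And.left

theorem class_shrink_of_mem (hsat : ∀ y z, y ∈ S → cl y z → z ∈ S) (hw : w ∈ S) :
    {l | cl w l ∨ (w ∈ S ∧ l ∈ S)} = S := by
  ext l
  exact ⟨fun hl => hl.elim (hsat w l hw) And.right, fun hl => .inr ⟨hw, hl⟩⟩

theorem IsForest.rooted_shrink (h : IsForest H d D I cl N) (hS : IsPetal D I cl N S) (hx : x ∈ D) :
    IsRooted H d (D ∪ S) (I \ S) (fun k l => cl k l ∨ (k ∈ S ∧ l ∈ S)) x (N x) := by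
  have hroot := h.rooted x hx
  refine { hroot with
    fixed_mem := fun y hy => .inl (hroot.fixed_mem y hy)
    inner := fun w hw => .inl (hroot.inner w hw.1)
    outer := fun k hk => ?_
    out := fun k hk => ?_ } <;> by_cases hkS : k ∈ S
  · by_cases hxk : N x k ∈ S
    · exact .inr (.inr ⟨hkS, hxk⟩)
    · have hkD := (hS.sub k hkS).resolve_right fun hkI => hxk (hS.inner x hx k hkS hkI)
      exact (hroot.outer k hkD).imp (fun hxkI => ⟨hxkI, hxk⟩) .inl
  · refine (hroot.outer k (hk.resolve_right hkS)).imp (fun hxkI => ⟨hxkI, fun hxk => hkS ?_⟩) .inl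
    rw [← hroot.invol k]
    exact hS.inner x hx _ hxk hxkI
  · rw [class_shrink_of_mem hS.sat hkS]
    exact hS.out x hx
  · simpa [hkS] using hroot.out k (hk.resolve_right hkS)

theorem IsForest.rooted_shrink_of_isRerooted (h : IsForest H d D I cl N)
    (hS : IsPetal D I cl N S) (hv : v ∈ D) (hw : w ∈ S) (hg : IsRerooted H (N v) S w g) :
    IsRooted H d (D ∪ S) (I \ S) (fun k l => cl k l ∨ (k ∈ S ∧ l ∈ S)) w g := by
  have hroot := h.rooted_shrink hS hv
  refine { hg.toIsMatch with
    self := hg.self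
    size := hg.size.trans hroot.size
    fixed_mem := fun y hy => ?_
    inner := fun w hw => ?_
    outer := fun k hk => ?_
    out := fun k hk => ?_ }
  · by_cases hyS : y ∈ S
    · exact .inr hyS
    · exact hroot.fixed_mem y (hg.eq_of_notMem y hyS ▸ hy)
  · rw [hg.eq_of_notMem w hw.2]
    exact hroot.inner w hw
  · by_cases hkS : k ∈ S
    · exact .inr (.inr ⟨hkS, hg.mapsTo k hkS⟩)
    · rw [hg.eq_of_notMem k hkS]
      exact hroot.outer k hk
  · by_cases hkS : k ∈ S
    · rw [class_shrink_of_mem hS.sat hkS]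
      refine ⟨w, ⟨hw, .inl hg.self⟩, fun y hy => hg.eq_of_fixed y hy.1 ?_⟩
      exact hy.2.resolve_right (not_not_intro (hg.mapsTo y hy.1))
    · have out_iff : ∀ s, Out g {l | cl k l ∨ (k ∈ S ∧ l ∈ S)} s ↔
          Out (N v) {l | cl k l ∨ (k ∈ S ∧ l ∈ S)} s := by
        refine fun s => and_congr_right fun hs => ?_
        have hks : cl k s := hs.resolve_right fun hs => hkS hs.1
        rw [hg.eq_of_notMem s fun hsS => hkS (hS.sat _ _ hsS (h.symm _ _ hks))]
      simpa only [out_iff] using hroot.out k hk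

theorem IsForest.shrink (h : IsForest H d D I cl N) (hS : IsPetal D I cl N S) (hv : v ∈ D)
    (hN : ∀ x ∈ D, N' x = N x) (hN' : ∀ w ∈ S, w ∈ I → IsRerooted H (N v) S w (N' w)) :
    IsForest H d (D ∪ S) (I \ S) (fun k l => cl k l ∨ (k ∈ S ∧ l ∈ S)) N' := by
  have old_or_new : ∀ x ∈ D ∪ S, x ∈ D ∨ (x ∈ S ∧ x ∈ I) := fun x hx =>
    hx.elim .inl fun hxS => (hS.sub x hxS).imp_right fun hxI => ⟨hxS, hxI⟩
  have eq_old : ∀ x ∈ D ∪ S, ∀ y, y ∉ S → ∃ z ∈ D, N' x y = N z y := by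
    intro x hx y hy
    rcases old_or_new x hx with hx | ⟨hxS, hxI⟩
    · exact ⟨x, hx, by rw [hN x hx]⟩
    · exact ⟨v, hv, (hN' x hxS hxI).eq_of_notMem y hy⟩
  refine { h.toIsPartition.shrink hS.sat with
    rooted := fun x hx => ?_
    rest := fun x hx y hy r hr hrI => ?_
    two_mates := fun w hw => ?_ }
  · rcases old_or_new x hx with hx | ⟨hxS, hxI⟩
    · rw [hN x hx]; exact h.rooted_shrink hS hx
    · exact h.rooted_shrink_of_isRerooted hS hv hxS (hN' x hxS hxI)
  · have hrS : r ∉ S := fun hrS => hr (.inr hrS)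
    obtain ⟨z, hz, hxz⟩ := eq_old x hx r hrS
    obtain ⟨z', hz', hyz'⟩ := eq_old y hy r hrS
    rw [hxz, hyz']
    exact h.rest z hz z' hz' r (fun hrD => hr (.inl hrD)) fun hrI' => hrI ⟨hrI', hrS⟩
  · obtain ⟨a, b, hab⟩ := h.two_mates w hw.1
    refine ⟨a, b, fun x hx => ?_⟩
    obtain ⟨z, hz, hxz⟩ := eq_old x hx w hw.2
    rw [hxz]
    exact hab z hz

end petal

section search

variable {d : ℕ} {D I S : Set V} {cl : V → V → Prop} {N N' N'' : V → V → V} {u v w : V}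

/-- The state of the search for a blossom through the edge `v u`: the petal `S` grows from the
blossom of `u` along the matching `N v`, and every inner vertex that it absorbs gets a matching
that misses it by an exchange along the edge `v u`. -/
structure IsSearch (D I : Set V) (cl : V → V → Prop) (N : V → V → V) (u v : V) (S : Set V)
    (N' : V → V → V) : Prop where
  petal : IsPetal D I cl N S
  mem : u ∈ S
  old : ∀ x ∈ D, N' x = N x
  new : ∀ w ∈ S, w ∈ I → ∃ T, IsPetal D I cl N T ∧ u ∈ T ∧ v ∉ T ∧ T ⊆ S ∧ w ∉ T ∧ N v w ∈ T ∧
    N' w = mix T u v (N u) (N v)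

theorem IsForest.isSearch_initial (h : IsForest H d D I cl N) (hu : u ∈ D) :
    IsSearch D I cl N u v {l | cl u l} N where
  petal := h.isPetal_class hu
  mem := h.refl u hu
  old _ _ := rfl
  new w hw hwI := absurd (h.mem_right hw) (h.disj w hwI)

theorem IsSearch.extend (hs : IsSearch D I cl N u v S N') (h : IsForest H d D I cl N)
    (hu : u ∈ D) (hv : v ∈ D) (hw : w ∉ S) (hvw : N v w ∈ S)
    (hnew : N'' w = mix S u v (N u) (N v)) (hold : ∀ x, x ≠ w → N'' x = N' x) :
    IsSearch D I cl N u v (S ∪ {w} ∪ {l | cl (N u w) l}) N'' where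
  petal := h.isPetal_extend hs.petal hu hv hs.mem hw hvw
  mem := .inl (.inl hs.mem)
  old x hx := by
    rw [hold x fun he => h.disj w (h.mem_inner_of_apply_mem hs.petal hv hw hvw) (he ▸ hx),
      hs.old x hx]
  new := by
    have hsub : S ⊆ S ∪ {w} ∪ {l | cl (N u w) l} := fun y hy => .inl (.inl hy)
    have hvS : v ∉ S := fun hvS => h.apply_notMem_of_mem hs.petal hv hvS hw hvw
    rintro y ((hy | rfl) | hy) hyI
    · obtain ⟨T, hT, huT, hvT, hTS, hyT, hvy, hmix⟩ := hs.new y hy hyI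
      refine ⟨T, hT, huT, hvT, hTS.trans hsub, hyT, hvy, ?_⟩
      rw [hold y fun he => hw (he ▸ hy), hmix]
    · exact ⟨S, hs.petal, hs.mem, hvS, hsub, hw, hvw, hnew⟩
    · exact absurd (h.mem_right hy) (h.disj y hyI)

theorem IsSearch.shrink [Finite V] (hs : IsSearch D I cl N u v S N') (h : IsForest H d D I cl N)
    (hu : u ∈ D) (hv : v ∈ D) (huv : H.Adj v u) (hvS : v ∈ S) :
    IsForest H d (D ∪ S) (I \ S) (fun k l => cl k l ∨ (k ∈ S ∧ l ∈ S)) N' := by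
  refine h.shrink hs.petal hv hs.old fun w hw hwI => ?_
  obtain ⟨T, hT, huT, hvT, hTS, hwT, hvw, hmix⟩ := hs.new w hw hwI
  exact hmix ▸ h.isRerooted_mix hs.petal hu hv hvS huv hT huT hvT hTS hwT hw hvw

theorem IsSearch.exists_inner (hs : IsSearch D I cl N u v S N') (h : IsForest H d D I cl N)
    (hcl : ¬ cl u v) (hu : u ∈ D) (hv : v ∈ D) (hvS : v ∈ S) : ∃ w ∈ S, w ∉ D := by
  by_contra! hno
  obtain ⟨s, ⟨hus, hout⟩, -⟩ := (h.rooted v hv).out u hu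
  have hsS : s ∈ S := hs.petal.sat _ _ hs.mem hus
  have hsv : s ≠ v := fun hsv => hcl (hsv ▸ hus)
  obtain ⟨hvsS, -, hvs⟩ := h.apply_mem_petal hs.petal hv hvS s hsS hsv
  rcases (h.rooted v hv).outer s (hno s hsS) with hI | hcl'
  · exact h.disj _ hI (hno _ hvsS)
  · exact hout.elim hvs fun hvs' => hvs' (h.trans _ _ _ hus hcl')

theorem IsSearch.augment [Finite V] (hs : IsSearch D I cl N u v S N') (h : IsForest H d D I cl N)
    (hu : u ∈ D) (hv : v ∈ D) (huv : H.Adj v u) (hvS : v ∉ S) (hclosed : ∀ w, w ∉ S → N v w ∉ S) :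
    IsMatch H (mix S u v (N u) (N v)) ∧ (fixedPoints (mix S u v (N u) (N v))).ncard < d := by
  have hpet := h.apply_mem_petal hs.petal hu hs.mem
  have hroot := h.rooted v hv
  constructor
  · exact isMatch_mix (h.rooted u hu).toIsMatch hroot.toIsMatch hs.mem hvS huv hroot.self
      fun y hy hyu => ⟨(hpet y hy hyu).1, (hpet y hy hyu).2.1⟩
  · exact hroot.size ▸ ncard_fixedPoints_mix_lt hs.mem hvS hroot.self
      (fun y hy hyu => (hpet y hy hyu).2.2) hclosed

end search

end Matching

/-! ## Greedy colourings by maximal independent sets -/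

theorem P3K1Free.of_embedding {V W : Type} {G : SimpleGraph V} {H : SimpleGraph W}
    (hG : P3K1Free G) (φ : H ↪g G) : P3K1Free H :=
  fun h => hG (h.trans ⟨φ⟩)

namespace P3K1Free

open Function SimpleGraph

variable {V : Type} {G : SimpleGraph V} {S : Set V} {k : ℕ} {p t u v x y z : V}

theorem adj_or_adj_or_adj (hG : P3K1Free G) (hxv : G.Adj x v) (hvy : G.Adj v y) (hne : x ≠ y)
    (hxy : ¬ G.Adj x y) (htx : t ≠ x) (htv : t ≠ v) (hty : t ≠ y) :
    G.Adj t x ∨ G.Adj t v ∨ G.Adj t y := by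
  by_contra! ⟨atx, atv, aty⟩
  let φ : Fin 3 ⊕ Fin 1 → V := Sum.elim ![x, v, y] fun _ => t
  have hinj : Injective φ := by
    rintro (a | a) (b | b) he
    · fin_cases a <;> fin_cases b <;>
        simp_all [φ, hxv.ne, hxv.ne', hvy.ne, hvy.ne', hne.symm]
    · fin_cases a <;> simp_all [φ]
    · fin_cases b <;> simp_all [φ]
    · simp [Subsingleton.elim a b]
  have hadj : ∀ i j, G.Adj (φ i) (φ j) ↔ (pathGraph 3 ⊕g completeGraph (Fin 1)).Adj i j := by
    rintro (a | a) (b | b)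
    · fin_cases a <;> fin_cases b <;>
        simp [φ, pathGraph_adj, hxv, hxv.symm, hvy, hvy.symm, hxy, mt G.adj_symm hxy]
    · fin_cases a <;> simp [φ, mt G.adj_symm atx, mt G.adj_symm atv, mt G.adj_symm aty]
    · fin_cases b <;> simp [φ, atx, atv, aty]
    · simp [φ, Subsingleton.elim a b]
  exact hG ⟨⟨⟨φ, hinj⟩, fun {i j} => hadj i j⟩⟩

theorem adj_of_isIndepSet_of_two_adj (hG : P3K1Free G) (hS : G.IsIndepSet S) (hx : x ∈ S)
    (hy : y ∈ S) (hz : z ∈ S) (hxy : x ≠ y) (hxv : G.Adj x v) (hyv : G.Adj y v) : G.Adj z v := by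
  by_cases hzx : z = x
  · rwa [hzx]
  by_cases hzy : z = y
  · rwa [hzy]
  have hzv : z ≠ v := by rintro rfl; exact hS hx hz (Ne.symm hzx) hxv
  have h := hG.adj_or_adj_or_adj hxv hyv.symm hxy (hS hx hy hxy) hzx hzv hzy
  exact (h.resolve_left (hS hz hx hzx)).resolve_right (hS hz hy hzy)

theorem adj_of_adj_of_exists_not_adj (hG : P3K1Free G) (hS : G.IsIndepSet S)
    (hcard : 2 < S.encard) (hu : u ∉ S) (hv : v ∉ S) (huv : G.Adj u v) (hp : p ∈ S)
    (hpu : G.Adj p u) (hnu : ∃ a ∈ S, ¬ G.Adj a u) (hnv : ∃ y ∈ S, G.Adj y v) : G.Adj p v := by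
  obtain ⟨a, ha, hau⟩ := hnu
  obtain ⟨y, hy, hyv⟩ := hnv
  by_contra hpv
  have hyp : y ≠ p := by rintro rfl; exact hpv hyv
  have hunique : ∀ q ∈ S, q ≠ p → ¬ G.Adj q u := fun q hq hqp hqu =>
    hau (hG.adj_of_isIndepSet_of_two_adj hS hq hp ha hqp hqu hpu)
  obtain ⟨t, ht, htpy⟩ : ∃ t ∈ S, t ∉ ({p, y} : Set V) := by
    by_contra! hsub
    have hle : S.encard ≤ 1 + 1 := (Set.encard_le_encard hsub).trans
      ((Set.encard_insert_le {y} p).trans_eq (by rw [Set.encard_singleton]))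
    exact hcard.not_ge (hle.trans_eq one_add_one_eq_two)
  simp only [Set.mem_insert_iff, Set.mem_singleton_iff, not_or] at htpy
  obtain ⟨htp, hty⟩ := htpy
  -- `u`, `v`, `y` is an induced path that `t` could only miss.
  rcases hG.adj_or_adj_or_adj huv hyv.symm (by rintro rfl; exact hu hy)
    (fun h => hunique y hy hyp h.symm) (by rintro rfl; exact hu ht) (by rintro rfl; exact hv ht)
    hty with h | h | h
  · exact hunique t ht htp h
  · exact hpv (hG.adj_of_isIndepSet_of_two_adj hS ht hy hp hty h hyv)
  · exact hS ht hy hty h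

theorem colorable_induce_compl (hG : P3K1Free G) (hS : G.IsIndepSet S) (hcard : 2 < S.encard)
    (hmax : ∀ v ∉ S, ∃ x ∈ S, G.Adj x v) (hk : G.Colorable (k + 1)) :
    (G.induce Sᶜ).Colorable k := by
  obtain ⟨c⟩ := hk
  obtain ⟨a, ha⟩ : S.Nonempty := Set.encard_pos.1 (pos_of_gt hcard)
  have : Nonempty V := ⟨a⟩
  choose! p hpS hpv using hmax
  -- A vertex `u` with the colour of `a` moves to the colour of its neighbour `p u` in `S`. As `u`
  -- is not adjacent to `a`, its neighbours outside `S` are also neighbours of `p u`.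
  have hmove : ∀ u ∉ S, ∀ v ∉ S, G.Adj u v → c u = c a → c (p u) ≠ c v := by
    intro u hu v hv huv hua
    exact c.valid (hG.adj_of_adj_of_exists_not_adj hS hcard hu hv huv (hpS u hu) (hpv u hu)
      ⟨a, ha, fun hau => c.valid hau hua.symm⟩ ⟨p v, hpS v hv, hpv v hv⟩)
  let c' : V → Fin (k + 1) := fun v => if c v = c a then c (p v) else c v
  have hc' : ∀ v : (Sᶜ : Set V), c' v ≠ c a := by
    rintro ⟨v, hv⟩
    simp only [c']
    split_ifs with hva
    · exact hva ▸ c.valid (hpv v hv)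
    · exact hva
  have hproper : ∀ u ∉ S, ∀ v ∉ S, G.Adj u v → c' u ≠ c' v := by
    intro u hu v hv huv
    simp only [c']
    split_ifs with hua hva hva
    · exact absurd (hua.trans hva.symm) (c.valid huv)
    · exact hmove u hu v hv huv hua
    · exact (hmove v hv u hu huv.symm hva).symm
    · exact c.valid huv
  have hcol : (G.induce Sᶜ).Coloring {i // i ≠ c a} :=
    Coloring.mk (fun v => ⟨c' v, hc' v⟩) fun {u v} huv h =>
      hproper u u.2 v v.2 huv (congrArg Subtype.val h)
  simpa using hcol.colorable

end P3K1Free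

namespace Matching

open Function Set

section TriangleFree

variable {V : Type*} {K : SimpleGraph V} {f rep : V → V} {k : ℕ}

theorem eq_of_coloring_compl {α : Type*} (hK : K.CliqueFree 3) (c : Kᶜ.Coloring α) {x y z : V}
    (hxy : x ≠ y) (hxz : x ≠ z) (hcy : c x = c y) (hcz : c x = c z) : y = z := by
  classical
  by_contra hyz
  have hadj : ∀ {a b}, a ≠ b → c a = c b → K.Adj a b := by
    intro a b hab hc
    by_contra hn
    exact c.valid ((K.compl_adj a b).2 ⟨hab, hn⟩) hc
  exact hK {x, y, z} (SimpleGraph.is3Clique_triple_iff.2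
    ⟨hadj hxy hcy, hadj hxz hcz, hadj hyz (hcy.symm.trans hcz)⟩)

theorem ncard_fiber_add_ncard_fixedPoints_le [Finite V] {α : Type*} (hK : K.CliqueFree 3)
    (c : Kᶜ.Coloring α) {g : V → V} (hg : ∀ x y, x ≠ y → c x = c y → g x ≠ x) (t : α) :
    (c ⁻¹' {t}).ncard + (fixedPoints g ∩ c ⁻¹' {t}).ncard ≤ 2 := by
  rcases (fixedPoints g ∩ c ⁻¹' {t}).eq_empty_or_nonempty with hempty | ⟨x, hx, rfl⟩
  · rw [hempty, ncard_empty]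
    by_contra! h
    obtain ⟨x, y, z, rfl, hy, hz, hxy, hxz, hyz⟩ := (two_lt_ncard_iff (toFinite _)).1 h
    exact hyz (eq_of_coloring_compl hK c hxy hxz (Eq.symm hy) (Eq.symm hz))
  · have hsub : c ⁻¹' {c x} ⊆ {x} := by
      intro y hy
      by_contra hyx
      exact hg x y (Ne.symm hyx) (Eq.symm hy) hx
    have h₁ := (ncard_le_ncard hsub).trans_eq (ncard_singleton x)
    have h₂ := ncard_le_ncard (s := fixedPoints g ∩ c ⁻¹' {c x}) inter_subset_right
    lia

theorem ncard_eq_sum_ncard_inter_fiber [Finite V] {α : Type*} [Fintype α] (S : Set V)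
    (c : V → α) : S.ncard = ∑ t, (S ∩ c ⁻¹' {t}).ncard := by
  classical
  have := Fintype.ofFinite V
  rw [ncard_eq_toFinset_card',
    Finset.card_eq_sum_card_fiberwise (t := Finset.univ) (f := c) fun _ _ => Finset.mem_univ _]
  refine Finset.sum_congr rfl fun t _ => ?_
  rw [← ncard_coe_finset]
  congr 1
  ext x
  simp

theorem exists_isMatch_of_colorable_compl [Finite V] (hK : K.CliqueFree 3)
    (hk : Kᶜ.Colorable k) : ∃ g, IsMatch K g ∧ Nat.card V + (fixedPoints g).ncard ≤ 2 * k := by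
  classical
  obtain ⟨c⟩ := hk
  let g : V → V := fun x => if h : ∃ y, x ≠ y ∧ c x = c y then h.choose else x
  have hg : ∀ x y, x ≠ y → c x = c y → g x = y := by
    intro x y hxy hc
    have h : ∃ y, x ≠ y ∧ c x = c y := ⟨y, hxy, hc⟩
    simp only [g, dif_pos h]
    exact eq_of_coloring_compl hK c h.choose_spec.1 hxy h.choose_spec.2 hc
  have hmate : ∀ x, g x ≠ x → c x = c (g x) := by
    intro x hx
    by_cases h : ∃ y, x ≠ y ∧ c x = c y
    · obtain ⟨y, hxy, hc⟩ := h
      rwa [hg x y hxy hc]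
    · exact absurd (dif_neg h) hx
  have hmatch : IsMatch K g := by
    refine ⟨fun x => ?_, fun x hx => ?_⟩
    · by_cases hx : g x = x
      · rw [hx, hx]
      · exact hg (g x) x hx (hmate x hx).symm
    · by_contra hn
      exact c.valid ((K.compl_adj _ _).2 ⟨Ne.symm hx, hn⟩) (hmate x hx)
  refine ⟨g, hmatch, ?_⟩
  rw [← ncard_univ, ncard_eq_sum_ncard_inter_fiber univ c,
    ncard_eq_sum_ncard_inter_fiber (fixedPoints g) c, ← Finset.sum_add_distrib]
  simp only [univ_inter]
  refine (Finset.sum_le_card_nsmul Finset.univ _ 2 fun t _ =>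
    ncard_fiber_add_ncard_fixedPoints_le hK c ?_ t).trans_eq (by simp [mul_comm])
  exact fun x y hxy hc => (hg x y hxy hc).trans_ne hxy.symm

theorem two_mul_ncard_range_le [Finite V] (hf : Involutive f) (hmem : ∀ x, rep x = x ∨ rep x = f x)
    (hrep : ∀ x, rep (f x) = rep x) :
    2 * (range rep).ncard ≤ Nat.card V + (fixedPoints f).ncard := by
  have hidem : ∀ x ∈ range rep, rep x = x := by
    rintro _ ⟨x, rfl⟩
    rcases hmem x with h | h
    · rw [h, h]
    · rw [h, hrep, h]
  have hinter : range rep ∩ f '' range rep ⊆ fixedPoints f := by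
    rintro _ ⟨hfx, x, hx, rfl⟩
    have hfix : f x = x := by rw [← hidem _ hfx, hrep, hidem x hx]
    exact congrArg f hfix
  have hcard := ncard_union_add_ncard_inter (range rep) (f '' range rep)
  rw [ncard_image_of_injective _ hf.injective] at hcard
  have h₁ := ncard_le_ncard hinter
  have h₂ := ncard_le_card (range rep ∪ f '' range rep)
  lia

theorem ncard_range_le_of_colorable_compl [Finite V] (hK : K.CliqueFree 3) (hf : IsMatch K f)
    (hmax : ∀ g, IsMatch K g → (fixedPoints f).ncard ≤ (fixedPoints g).ncard)
    (hmem : ∀ x, rep x = x ∨ rep x = f x) (hrep : ∀ x, rep (f x) = rep x)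
    (hk : Kᶜ.Colorable k) : (range rep).ncard ≤ k := by
  obtain ⟨g, hg, hle⟩ := exists_isMatch_of_colorable_compl hK hk
  have hfg := hmax g hg
  have hrange := two_mul_ncard_range_le hf.invol hmem hrep
  lia

end TriangleFree

end Matching

/-- The complement of `G` restricted to edges within `U`. Colour classes of size two of `G.induce U`
are the edges of this graph, which lives on all of `V` to avoid subtypes. -/
def coGraph {V : Type*} (G : SimpleGraph V) (U : Set V) : SimpleGraph V where
  Adj x y := x ∈ U ∧ y ∈ U ∧ x ≠ y ∧ ¬ G.Adj x y
  symm := ⟨fun _ _ h => ⟨h.2.1, h.1, h.2.2.1.symm, fun h' => h.2.2.2 h'.symm⟩⟩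

theorem colorable_compl_coGraph {V : Type*} [Finite V] {G : SimpleGraph V} {U X : Set V} {k : ℕ}
    (hXU : X ⊆ U) (hk : (G.induce X).Colorable k) :
    (coGraph G U)ᶜ.Colorable (k + Xᶜ.ncard) := by
  classical
  have := Fintype.ofFinite V
  obtain ⟨c⟩ := hk
  let c' : V → Fin k ⊕ (Xᶜ : Set V) :=
    fun x => if hx : x ∈ X then .inl (c ⟨x, hx⟩) else .inr ⟨x, hx⟩
  have hc' : (coGraph G U)ᶜ.Coloring (Fin k ⊕ (Xᶜ : Set V)) := by
    refine SimpleGraph.Coloring.mk c' fun {x y} hxy heq => ?_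
    rw [SimpleGraph.compl_adj] at hxy
    simp only [c'] at heq
    split_ifs at heq with hx hy hy
    · refine c.valid (v := ⟨x, hx⟩) (w := ⟨y, hy⟩) ?_ (Sum.inl.inj heq)
      by_contra hn
      exact hxy.2 ⟨hXU hx, hXU hy, hxy.1, hn⟩
    · exact hxy.1 (congrArg Subtype.val (Sum.inr.inj heq))
  have hcard : Fintype.card (Fin k ⊕ (Xᶜ : Set V)) = k + Xᶜ.ncard := by
    rw [Fintype.card_sum, Fintype.card_fin, ← Nat.card_eq_fintype_card, Nat.card_coe_set_eq]
  exact hcard ▸ hc'.colorable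

theorem Matching.IsMatch.mem_of_coGraph {V : Type*} {G : SimpleGraph V} {U : Set V} {f : V → V}
    (hf : IsMatch (coGraph G U) f) {x y : V} (hx : x ∈ U) (hy : y = x ∨ y = f x) : y ∈ U := by
  rcases hy with rfl | rfl
  · exact hx
  · by_cases hfx : f x = x
    · rwa [hfx]
    · exact (hf.adj x hfx).2.1

/-- All vertices outside `U` are coloured by `c` in a way that every modulator to a
`(P₃ + K₁)`-free graph pays for. Colours are represented by vertices outside `U`. -/
structure IsGreedy {V : Type} (G : SimpleGraph V) (U : Set V) (c : V → V) : Prop where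
  notMem : ∀ x ∉ U, c x ∉ U
  proper : ∀ x ∉ U, ∀ y ∉ U, G.Adj x y → c x ≠ c y
  bound : ∀ (M : Set V) (k : ℕ), P3K1Free (G.induce Mᶜ) → (G.induce Mᶜ).Colorable k →
    ∃ l, (G.induce (U \ M)).Colorable l ∧ (c '' Uᶜ).ncard + l + (M ∩ U).ncard ≤ k + M.ncard

namespace IsGreedy

open Function Set SimpleGraph Matching

variable {V : Type} {G : SimpleGraph V} {U S : Set V} {c c' : V → V} {a : V}

theorem univ (G : SimpleGraph V) (c : V → V) : IsGreedy G Set.univ c where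
  notMem x hx := absurd (mem_univ x) hx
  proper x hx := absurd (mem_univ x) hx
  bound M k _ hk := ⟨k, by rwa [← compl_eq_univ_sdiff], by simp⟩

theorem colorable_sdiff_of_disjoint {M : Set V} {l : ℕ} (hM : P3K1Free (G.induce Mᶜ))
    (hl : (G.induce (U \ M)).Colorable l) (hSU : S ⊆ U) (hS : G.IsIndepSet S)
    (hcard : 2 < S.encard) (hmax : ∀ v ∈ U, v ∉ S → ∃ x ∈ S, G.Adj x v) (hSM : Disjoint S M) :
    ∃ l', l = l' + 1 ∧ (G.induce ((U \ S) \ M)).Colorable l' := by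
  have hSUM : S ⊆ U \ M := fun x hx => ⟨hSU hx, disjoint_left.1 hSM hx⟩
  obtain ⟨a, ha⟩ : S.Nonempty := encard_pos.1 (pos_of_gt hcard)
  obtain _ | l := l
  · obtain ⟨d⟩ := hl
    exact (d ⟨a, hSUM ha⟩).elim0
  let T : Set (U \ M : Set V) := Subtype.val ⁻¹' S
  have hT : (G.induce (U \ M)).IsIndepSet T := fun x hx y hy hne =>
    hS hx hy (Subtype.coe_injective.ne hne)
  have hTcard : 2 < T.encard := by
    rwa [encard_preimage_of_injective_subset_range Subtype.coe_injective
      (hSUM.trans_eq Subtype.range_coe.symm)]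
  have hTmax : ∀ v ∉ T, ∃ x ∈ T, (G.induce (U \ M)).Adj x v := by
    intro v hv
    obtain ⟨x, hx, hxv⟩ := hmax v v.2.1 hv
    exact ⟨⟨x, hSUM hx⟩, hx, hxv⟩
  have hfree : P3K1Free (G.induce (U \ M)) :=
    hM.of_embedding (induceHomOfLE G fun _ hx => hx.2)
  refine ⟨l, rfl, (hfree.colorable_induce_compl hT hTcard hTmax hl).of_hom ?_⟩
  exact ⟨fun x => ⟨⟨x, x.2.1.1, x.2.2⟩, x.2.1.2⟩, fun h => h⟩

theorem sdiff [Finite V] (h : IsGreedy G U c) (hSU : S ⊆ U) (hS : G.IsIndepSet S)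
    (hcard : 2 < S.encard) (hmax : ∀ v ∈ U, v ∉ S → ∃ x ∈ S, G.Adj x v) (ha : a ∈ S)
    (hc'S : ∀ x ∈ S, c' x = a) (hc' : ∀ x ∉ S, c' x = c x) : IsGreedy G (U \ S) c' where
  notMem x hx := by
    by_cases hxS : x ∈ S
    · exact fun h' => h'.2 (hc'S x hxS ▸ ha)
    · exact fun h' => h.notMem x (fun hxU => hx ⟨hxU, hxS⟩) (hc' x hxS ▸ h'.1)
  proper x hx y hy hxy := by
    by_cases hxS : x ∈ S <;> by_cases hyS : y ∈ S
    · exact absurd hxy (hS hxS hyS hxy.ne)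
    · rw [hc'S x hxS, hc' y hyS]
      exact fun he => h.notMem y (fun hyU => hy ⟨hyU, hyS⟩) (he ▸ hSU ha)
    · rw [hc'S y hyS, hc' x hxS]
      exact fun he => h.notMem x (fun hxU => hx ⟨hxU, hxS⟩) (he ▸ hSU ha)
    · rw [hc' x hxS, hc' y hyS]
      exact h.proper x (fun hxU => hx ⟨hxU, hxS⟩) y (fun hyU => hy ⟨hyU, hyS⟩) hxy
  bound M k hM hk := by
    obtain ⟨l, hl, hle⟩ := h.bound M k hM hk
    have hcolours : (c' '' (U \ S)ᶜ).ncard ≤ (c '' Uᶜ).ncard + 1 := by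
      refine (ncard_le_ncard ?_).trans (ncard_insert_le a _)
      rintro _ ⟨x, hx, rfl⟩
      by_cases hxS : x ∈ S
      · exact .inl (hc'S x hxS)
      · exact .inr ⟨x, fun hxU => hx ⟨hxU, hxS⟩, (hc' x hxS).symm⟩
    by_cases hSM : Disjoint S M
    · obtain ⟨l', rfl, hl'⟩ := colorable_sdiff_of_disjoint hM hl hSU hS hcard hmax hSM
      have hMU : (M ∩ (U \ S)).ncard ≤ (M ∩ U).ncard :=
        ncard_le_ncard (inter_subset_inter_right M sdiff_subset)
      exact ⟨l', hl', by lia⟩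
    · obtain ⟨x, hxS, hxM⟩ := not_disjoint_iff.1 hSM
      have hMU : (M ∩ (U \ S)).ncard < (M ∩ U).ncard :=
        ncard_lt_ncard ⟨inter_subset_inter_right M sdiff_subset,
          fun hsub => (hsub ⟨hxM, hSU hxS⟩).2.2 hxS⟩
      refine ⟨l, hl.of_hom (induceHomOfLE G ?_).toHom, by lia⟩
      exact sdiff_subset_sdiff_left sdiff_subset

variable {f rep col : V → V} {k l : ℕ} {M : Set V}

theorem ncard_image_le_of_colorable [Finite V] (hK : (coGraph G U).CliqueFree 3)
    (hf : IsMatch (coGraph G U) f)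
    (hmax : ∀ g, IsMatch (coGraph G U) g → (fixedPoints f).ncard ≤ (fixedPoints g).ncard)
    (hmem : ∀ x, rep x = x ∨ rep x = f x) (hrep : ∀ x, rep (f x) = rep x)
    (hl : (G.induce (U \ M)).Colorable l) : (rep '' U).ncard ≤ l + (M ∩ U).ncard := by
  have hrange := ncard_range_le_of_colorable_compl hK hf hmax hmem hrep
    (colorable_compl_coGraph sdiff_subset hl)
  have hfix : ∀ x ∉ U, rep x = x := fun x hx =>
    (hmem x).elim id fun h => h.trans (by_contra fun hfx => hx (hf.adj x hfx).1)
  have hrepU : ∀ x ∈ U, rep x ∈ U := fun x hx => hf.mem_of_coGraph hx (hmem x)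
  have hsplit : rep '' U ∪ Uᶜ ⊆ range rep :=
    union_subset (image_subset_range rep U) fun x hx => ⟨x, hfix x hx⟩
  have hdisj : Disjoint (rep '' U) Uᶜ :=
    disjoint_compl_right_iff_subset.2 (image_subset_iff.2 hrepU)
  have h₁ := ncard_le_ncard hsplit
  rw [ncard_union_eq hdisj] at h₁
  have h₂ : (U \ M)ᶜ.ncard ≤ Uᶜ.ncard + (M ∩ U).ncard := by
    refine (ncard_le_ncard fun x hx => ?_).trans (ncard_union_le _ _)
    by_cases hxU : x ∈ U
    · exact .inr ⟨by_contra fun hxM => hx ⟨hxU, hxM⟩, hxU⟩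
    · exact .inl hxU
  lia

theorem ncard_range_le [Finite V] (h : IsGreedy G U c) (hK : (coGraph G U).CliqueFree 3)
    (hf : IsMatch (coGraph G U) f)
    (hmax : ∀ g, IsMatch (coGraph G U) g → (fixedPoints f).ncard ≤ (fixedPoints g).ncard)
    (hmem : ∀ x, rep x = x ∨ rep x = f x) (hrep : ∀ x, rep (f x) = rep x)
    (hcolU : ∀ x ∈ U, col x = rep x) (hcol : ∀ x ∉ U, col x = c x)
    (hM : P3K1Free (G.induce Mᶜ)) (hk : (G.induce Mᶜ).Colorable k) :
    (range col).ncard ≤ k + M.ncard := by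
  obtain ⟨l, hl, hle⟩ := h.bound M k hM hk
  have hU := ncard_image_le_of_colorable hK hf hmax hmem hrep hl
  have hsub : range col ⊆ c '' Uᶜ ∪ rep '' U := by
    rintro _ ⟨x, rfl⟩
    by_cases hx : x ∈ U
    · exact .inr ⟨x, hx, (hcolU x hx).symm⟩
    · exact .inl ⟨x, hx, (hcol x hx).symm⟩
  have hcard := (ncard_le_ncard hsub).trans (ncard_union_le _ _)
  lia

theorem ne_of_adj (h : IsGreedy G U c) (hf : IsMatch (coGraph G U) f)
    (hmem : ∀ x, rep x = x ∨ rep x = f x) (hcolU : ∀ x ∈ U, col x = rep x)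
    (hcol : ∀ x ∉ U, col x = c x) {x y : V} (hxy : G.Adj x y) : col x ≠ col y := by
  have hrepU : ∀ x ∈ U, rep x ∈ U := fun x hx => hf.mem_of_coGraph hx (hmem x)
  have hmate : ∀ {x y}, G.Adj x y → f x ≠ y := by
    rintro x _ hadj rfl
    exact (hf.adj x hadj.ne').2.2.2 hadj
  by_cases hx : x ∈ U <;> by_cases hy : y ∈ U
  · rw [hcolU x hx, hcolU y hy]
    rcases hmem x with hrx | hrx <;> rcases hmem y with hry | hry <;> rw [hrx, hry]
    · exact hxy.ne
    · exact (hmate hxy.symm).symm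
    · exact hmate hxy
    · exact hf.invol.injective.ne hxy.ne
  · rw [hcolU x hx, hcol y hy]
    exact fun he => h.notMem y hy (he ▸ hrepU x hx)
  · rw [hcol x hx, hcolU y hy]
    exact fun he => h.notMem x hx (he ▸ hrepU y hy)
  · rw [hcol x hx, hcol y hy]
    exact h.proper x hx y hy hxy

end IsGreedy

/-! ## The algorithm -/

/-- Applies the functions `g i` one after the other. -/
def sweep {α : Type*} {n : ℕ} (g : Fin n → α → α) (s : α) : α := (List.finRange n).foldr g s

namespace Ram

namespace PolyTime

variable {Γ : ℕ → Type} [Data Γ]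

theorem weaken {Δ Θ : ℕ → Type} [Data Δ] [Data Θ] {f : ∀ n, Γ n → Δ n} (hf : PolyTime f) :
    PolyTime fun n (x : Γ n × Θ n) => f n x.1 :=
  hf.comp PolyTime.id.fst

theorem last {Δ : ℕ → Type} [Data Δ] : PolyTime fun n (x : Γ n × Δ n) => x.2 := PolyTime.id.snd

protected theorem imp {φ ψ : ∀ n, Γ n → Prop} (hφ : PolyTime φ) (hψ : PolyTime ψ) :
    PolyTime fun n x => φ n x → ψ n x := by
  simpa only [imp_iff_not_or] using hφ.not.or hψ

theorem mem {S : ∀ n, Γ n → Set (Fin n)} {i : ∀ n, Γ n → Fin n} (hi : PolyTime i)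
    (hS : PolyTime S) : PolyTime fun n x => i n x ∈ S n x :=
  app (f := S) hS hi

theorem of_mem {S : ∀ n, Γ n → Set (Fin n)}
    (hS : PolyTime fun n (x : Γ n × Fin n) => x.2 ∈ S n x.1) : PolyTime S :=
  lam (T := fun _ => Prop) hS

theorem union {S T : ∀ n, Γ n → Set (Fin n)} (hS : PolyTime S) (hT : PolyTime T) :
    PolyTime fun n x => S n x ∪ T n x :=
  of_mem <| (mem last hS.weaken).or (mem last hT.weaken)

theorem sdiff {S T : ∀ n, Γ n → Set (Fin n)} (hS : PolyTime S) (hT : PolyTime T) :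
    PolyTime fun n x => S n x \ T n x :=
  of_mem <| (mem last hS.weaken).and (mem last hT.weaken).not

theorem singleton {i : ∀ n, Γ n → Fin n} (hi : PolyTime i) :
    PolyTime fun n x => ({i n x} : Set (Fin n)) :=
  of_mem <| last.eq hi.weaken

protected theorem sweep {Δ : ℕ → Type} [Data Δ] [Storable Δ] {f : ∀ n, Γ n → Fin n → Δ n → Δ n}
    (hf : PolyTime₂ fun n (x : Γ n × Fin n) => f n x.1 x.2) :
    PolyTime₂ fun n x => sweep (f n x) :=
  foldr (f := fun n x => f n x.1)
    (hf.comp ((PolyTime.id.fst.fst.fst.prodMk PolyTime.id.snd).prodMk PolyTime.id.fst.snd)) last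

end PolyTime

end Ram

open Classical in
/-- `S` together with `v` if that is an independent subset of `U`, otherwise `S`. -/
noncomputable def extendIndep {V : Type*} (G : SimpleGraph V) (U : Set V) (v : V) (S : Set V) :
    Set V :=
  if v ∈ U ∧ v ∉ S ∧ ∀ x, x ∈ S → ¬ G.Adj x v then S ∪ {v} else S

/-- A maximal independent subset of `U` that contains the independent set `S`. -/
noncomputable def maximalIndep {n : ℕ} (G : SimpleGraph (Fin n)) (U S : Set (Fin n)) :
    Set (Fin n) :=
  (sweep (extendIndep G U))^[n] S

open Classical in
/-- Gives the colour `a` to a maximal independent set with the vertices `a`, `b`, `c`, and removes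
it from the set of uncoloured vertices, if these vertices are uncoloured and independent. -/
noncomputable def colourTriple {n : ℕ} (G : SimpleGraph (Fin n)) (a b c : Fin n)
    (s : Set (Fin n) × (Fin n → Fin n)) : Set (Fin n) × (Fin n → Fin n) :=
  if (coGraph G s.1).Adj a b ∧ (coGraph G s.1).Adj a c ∧ (coGraph G s.1).Adj b c then
    (s.1 \ maximalIndep G s.1 {a, b, c}, fun x =>
      if x ∈ maximalIndep G s.1 {a, b, c} then a else s.2 x)
  else s

/-- The set of vertices that the greedy algorithm leaves uncoloured, and its colouring of the
others. -/
noncomputable def greedy {n : ℕ} (G : SimpleGraph (Fin n)) : Set (Fin n) × (Fin n → Fin n) :=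
  (sweep fun a => sweep fun b => sweep fun c => colourTriple G a b c)^[n] (Set.univ, id)

namespace Ram.PolyTime

variable {Γ : ℕ → Type} [Data Γ] {G : ∀ n, Γ n → SimpleGraph (Fin n)} {U S : ∀ n, Γ n → Set (Fin n)}
  {a b c : ∀ n, Γ n → Fin n} {s : ∀ n, Γ n → Set (Fin n) × (Fin n → Fin n)}

protected theorem coGraph (hG : PolyTime G) (hU : PolyTime U) :
    PolyTime fun n x => coGraph (G n x) (U n x) :=
  of_adj <| lam <| lam <| (mem last.weaken hU.weaken.weaken).and <|
    (mem last hU.weaken.weaken).and <| (last.weaken.eq last).not.and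
      ((hG.weaken.weaken.adj.app last.weaken).app last).not

open Classical in
protected theorem extendIndep (hG : PolyTime G) (hU : PolyTime U) (ha : PolyTime a)
    (hS : PolyTime S) : PolyTime fun n x => extendIndep (G n x) (U n x) (a n x) (S n x) :=
  ((mem ha hU).and <| (mem ha hS).not.and <| forall_fin <|
    (mem last hS.weaken).imp ((hG.weaken.adj.app last).app ha.weaken).not).ite
      (hS.union ha.singleton) hS

protected theorem maximalIndep (hG : PolyTime G) (hU : PolyTime U) (hS : PolyTime S) :
    PolyTime fun n x => maximalIndep (G n x) (U n x) (S n x) :=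
  iterate (.sweep <| .extendIndep hG.weaken.weaken hU.weaken.weaken last.weaken last) hS

open Classical in
protected theorem colourTriple (hG : PolyTime G) (ha : PolyTime a) (hb : PolyTime b)
    (hc : PolyTime c) (hs : PolyTime s) :
    PolyTime fun n x => colourTriple (G n x) (a n x) (b n x) (c n x) (s n x) := by
  have hH := hG.coGraph hs.fst
  have hT := hG.maximalIndep hs.fst (ha.singleton.union (hb.singleton.union hc.singleton))
  exact (((hH.adj.app ha).app hb).and <| ((hH.adj.app ha).app hc).and ((hH.adj.app hb).app hc)).ite
    ((hs.fst.sdiff hT).prodMk <| lam <|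
      (mem last hT.weaken).ite ha.weaken (hs.snd.weaken.app last)) hs

protected theorem greedy (hG : PolyTime G) : PolyTime fun n x => greedy (G n x) :=
  iterate (.sweep <| .sweep <| .sweep <| .colourTriple hG.weaken.weaken.weaken.weaken
    last.weaken.weaken.weaken last.weaken.weaken last.weaken last)
    ((of_mem (.const (p := True))).prodMk (lam last))

end Ram.PolyTime

/-- On the states with the invariant `Inv`, the step `g` increases the measure `μ` if it is enabled,
and does nothing otherwise. -/
structure IsProgress {α : Type*} (Inv En : α → Prop) (μ : α → ℕ) (g : α → α) : Prop where
  progress : ∀ s, Inv s → En s → Inv (g s) ∧ μ s < μ (g s)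
  stuck : ∀ s, Inv s → ¬ En s → g s = s

namespace IsProgress

variable {α : Type*} {Inv : α → Prop} {μ : α → ℕ} {n : ℕ}

theorem sweep {En : Fin n → α → Prop} {g : Fin n → α → α}
    (h : ∀ i, IsProgress Inv (En i) μ (g i)) :
    IsProgress Inv (fun s => ∃ i, En i s) μ (sweep g) := by
  have key : ∀ (L : List (Fin n)) (s : α), Inv s → Inv (L.foldr g s) ∧
      ((∀ i ∈ L, ¬ En i s) ∧ L.foldr g s = s ∨ (∃ i ∈ L, En i s) ∧ μ s < μ (L.foldr g s)) := by
    intro L s hs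
    induction L with
    | nil => simp [hs]
    | cons i L ih =>
      obtain ⟨hinv, ih⟩ := ih
      rw [List.foldr_cons]
      by_cases hi : En i (L.foldr g s)
      · obtain ⟨hinv', hlt⟩ := (h i).progress _ hinv hi
        grind
      · rw [(h i).stuck _ hinv hi]
        grind
  refine ⟨fun s hs ⟨i, hi⟩ => ?_, fun s hs hno => ?_⟩
  · have := key (List.finRange n) s hs
    grind [_root_.sweep]
  · have := key (List.finRange n) s hs
    grind [_root_.sweep]

theorem iterate {En : α → Prop} {g : α → α} (h : IsProgress Inv En μ g) {m : ℕ}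
    (hμ : ∀ s, Inv s → μ s ≤ m) (k : ℕ) {s : α} (hs : Inv s) (hk : m ≤ μ s + k) :
    Inv (g^[k] s) ∧ ¬ En (g^[k] s) := by
  induction k generalizing s with
  | zero =>
    refine ⟨hs, fun hen => ?_⟩
    obtain ⟨hinv, hlt⟩ := h.progress s hs hen
    exact absurd (hμ _ hinv) (by simpa using hk.trans_lt hlt)
  | succ k ih =>
    by_cases hen : En s
    · obtain ⟨hinv, hlt⟩ := h.progress s hs hen
      exact ih hinv (by omega)
    · rw [Function.iterate_fixed (h.stuck s hs hen)]
      exact ⟨hs, hen⟩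

end IsProgress

theorem ncard_fin_le {n : ℕ} (S : Set (Fin n)) : S.ncard ≤ n :=
  (Set.ncard_le_card S).trans_eq (Nat.card_fin n)

section greedy

open Set SimpleGraph

variable {n : ℕ} {G : SimpleGraph (Fin n)} {U S : Set (Fin n)}

theorem isProgress_extendIndep {V : Type*} [Finite V] (G : SimpleGraph V) (U S₀ : Set V) (v : V) :
    IsProgress (fun S => S₀ ⊆ S ∧ S ⊆ U ∧ G.IsIndepSet S)
      (fun S => v ∈ U ∧ v ∉ S ∧ ∀ x, x ∈ S → ¬ G.Adj x v) ncard (extendIndep G U v) where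
  progress S hS hv := by
    rw [extendIndep, if_pos hv, union_singleton]
    refine ⟨⟨hS.1.trans (subset_insert v S), insert_subset hv.1 hS.2.1, hS.2.2.insert fun x hx _ =>
      ⟨fun h => hv.2.2 x hx h.symm, hv.2.2 x hx⟩⟩, ?_⟩
    rw [ncard_insert_of_notMem hv.2.1]
    exact Nat.lt_succ_self _
  stuck S _ hv := if_neg hv

theorem maximalIndep_spec (hSU : S ⊆ U) (hS : G.IsIndepSet S) :
    S ⊆ maximalIndep G U S ∧ maximalIndep G U S ⊆ U ∧ G.IsIndepSet (maximalIndep G U S) ∧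
      ∀ v ∈ U, v ∉ maximalIndep G U S → ∃ x ∈ maximalIndep G U S, G.Adj x v := by
  obtain ⟨⟨hsub, hU, hindep⟩, hmax⟩ := (IsProgress.sweep fun v => isProgress_extendIndep G U S v)
    |>.iterate (m := n) (fun T _ => ncard_fin_le T) n
      ⟨subset_rfl, hSU, hS⟩ (Nat.le_add_left _ _)
  exact ⟨hsub, hU, hindep, by simpa [maximalIndep] using hmax⟩

theorem isProgress_colourTriple (G : SimpleGraph (Fin n)) (a b c : Fin n) :
    IsProgress (fun s => IsGreedy G s.1 s.2) (fun s => (coGraph G s.1).Adj a b ∧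
      (coGraph G s.1).Adj a c ∧ (coGraph G s.1).Adj b c) (fun s => s.1ᶜ.ncard)
      (colourTriple G a b c) where
  progress s hs habc := by
    obtain ⟨hab, hac, hbc⟩ := habc
    obtain ⟨hsub, hU, hindep, hmax⟩ := maximalIndep_spec (G := G) (U := s.1) (S := {a, b, c})
      (by grind [coGraph]) (by
        grind [coGraph, Set.Pairwise, SimpleGraph.adj_comm])
    rw [colourTriple, if_pos ⟨hab, hac, hbc⟩]
    set T := maximalIndep G s.1 {a, b, c}
    have hcard : 2 < T.encard := by
      refine lt_of_lt_of_le ?_ (encard_le_encard hsub)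
      rw [encard_insert_of_notMem (by simp [hab.ne, hac.ne]), encard_pair hbc.ne]
      norm_num
    refine ⟨hs.sdiff hU hindep hcard hmax (hsub (mem_insert a _)) (fun x hx => if_pos hx)
      fun x hx => if_neg hx, ncard_lt_ncard ?_⟩
    exact compl_lt_compl_iff_lt.2 <|
      sdiff_ssubset_left_iff.2 ⟨a, hU (hsub (mem_insert a _)), hsub (mem_insert a _)⟩
  stuck s _ habc := if_neg habc

theorem greedy_spec (G : SimpleGraph (Fin n)) :
    IsGreedy G (greedy G).1 (greedy G).2 ∧ (coGraph G (greedy G).1).CliqueFree 3 := by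
  obtain ⟨hinv, hmax⟩ := (IsProgress.sweep fun a => .sweep fun b => .sweep fun c =>
    isProgress_colourTriple G a b c) |>.iterate (m := n) (s := (univ, id))
      (fun s _ => ncard_fin_le s.1ᶜ) n (IsGreedy.univ G id)
      (Nat.le_add_left _ _)
  refine ⟨hinv, fun t ht => ?_⟩
  obtain ⟨a, b, c, hab, hac, hbc, -⟩ := is3Clique_iff.1 ht
  exact hmax ⟨a, b, c, hab, hac, hbc⟩

end greedy

section blossom

open Function Set

variable {n : ℕ}

namespace Matching

open Classical in
/-- Extends the petal `p.1` by the vertex `w` and the blossom that `N u` matches with it, if `N v`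
matches `w` with a vertex of the petal, and makes `p.2 w` a matching that misses `w`. -/
noncomputable def extendPetal (cl : Fin n → Fin n → Prop) (N : Fin n → Fin n → Fin n)
    (u v w : Fin n) (p : Set (Fin n) × (Fin n → Fin n → Fin n)) :
    Set (Fin n) × (Fin n → Fin n → Fin n) :=
  if w ∉ p.1 ∧ N v w ∈ p.1 then
    (p.1 ∪ {w} ∪ {l | cl (N u w) l}, fun x => if x = w then mix p.1 u v (N u) (N v) else p.2 x)
  else p

/-- The petal of the edge `v u` between two outer vertices, and matchings that miss its vertices. -/
noncomputable def search (cl : Fin n → Fin n → Prop) (N : Fin n → Fin n → Fin n) (u v : Fin n) :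
    Set (Fin n) × (Fin n → Fin n → Fin n) :=
  (sweep (extendPetal cl N u v))^[n] ({l | cl u l}, N)

/-- The state of the blossom algorithm: a matching and an alternating forest. -/
abbrev SearchState (n : ℕ) : Type :=
  (Fin n → Fin n) × Set (Fin n) × Set (Fin n) × (Fin n → Fin n → Prop) × (Fin n → Fin n → Fin n)

namespace SearchState

/-- The current matching. -/
abbrev matching (s : SearchState n) : Fin n → Fin n := s.1

/-- The outer vertices of the alternating forest. -/
abbrev outer (s : SearchState n) : Set (Fin n) := s.2.1

/-- The inner vertices of the alternating forest. -/
abbrev inner (s : SearchState n) : Set (Fin n) := s.2.2.1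

/-- The partition of the outer vertices into blossoms, as an equivalence relation. -/
abbrev blossom (s : SearchState n) : Fin n → Fin n → Prop := s.2.2.2.1

/-- For every outer vertex, a matching that misses it. -/
abbrev missing (s : SearchState n) : Fin n → Fin n → Fin n := s.2.2.2.2

/-- The forest without edges on the unmatched vertices of `f`. -/
def start (f : Fin n → Fin n) : SearchState n :=
  (f, fixedPoints f, ∅, fun x y => x = y ∧ x ∈ fixedPoints f, fun _ => f)

open Classical in
/-- Hangs the matching edge of the new inner vertex `u` on the outer vertex `v`. -/
noncomputable def grow (s : SearchState n) (v u : Fin n) : SearchState n :=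
  (s.matching, s.outer ∪ {s.missing v u}, s.inner ∪ {u},
    fun k l => s.blossom k l ∨ (k = s.missing v u ∧ l = s.missing v u),
    fun x => if x = s.missing v u then mix {u} u v (s.missing v) (s.missing v) else s.missing x)

/-- The petal that the edge `v u` closes, and matchings that miss its vertices. -/
noncomputable def petal (s : SearchState n) (v u : Fin n) :
    Set (Fin n) × (Fin n → Fin n → Fin n) :=
  search s.blossom s.missing u v

/-- Merges the petal of the edge `v u` into one blossom. -/
noncomputable def shrink (s : SearchState n) (v u : Fin n) : SearchState n :=
  (s.matching, s.outer ∪ (s.petal v u).1, s.inner \ (s.petal v u).1,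
    fun k l => s.blossom k l ∨ (k ∈ (s.petal v u).1 ∧ l ∈ (s.petal v u).1), (s.petal v u).2)

/-- Augments the matching along the edge `v u` between two trees, and restarts. -/
noncomputable def augment (s : SearchState n) (v u : Fin n) : SearchState n :=
  start (mix (s.petal v u).1 u v (s.missing u) (s.missing v))

open Classical in
/-- Treats the edge `v u` if the outer vertex `v` is adjacent to a vertex `u` that is neither an
inner vertex nor in the blossom of `v`. -/
noncomputable def advance (H : SimpleGraph (Fin n)) (v u : Fin n) (s : SearchState n) :
    SearchState n :=
  if v ∈ s.outer ∧ H.Adj v u ∧ u ∉ s.inner ∧ ¬ s.blossom v u then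
    if u ∈ s.outer then
      if v ∈ (s.petal v u).1 then s.shrink v u else s.augment v u
    else s.grow v u
  else s

end SearchState

/-- The maximum matching that the blossom algorithm finds. -/
noncomputable def maxMatching (H : SimpleGraph (Fin n)) : Fin n → Fin n :=
  (((sweep fun v => sweep fun u => SearchState.advance H v u)^[n + 1])^[n + 1]
    (SearchState.start id)).matching

theorem isProgress_extendPetal {H : SimpleGraph (Fin n)} {d : ℕ} {D I : Set (Fin n)}
    {cl : Fin n → Fin n → Prop} {N : Fin n → Fin n → Fin n} {u v : Fin n}
    (h : IsForest H d D I cl N) (hu : u ∈ D) (hv : v ∈ D) (w : Fin n) :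
    IsProgress (fun p => IsSearch D I cl N u v p.1 p.2) (fun p => w ∉ p.1 ∧ N v w ∈ p.1)
      (fun p => p.1.ncard) (extendPetal cl N u v w) where
  progress p hp hw := by
    rw [extendPetal, if_pos hw]
    refine ⟨hp.extend h hu hv hw.1 hw.2 (if_pos rfl) fun x hx => if_neg hx, ncard_lt_ncard ?_⟩
    exact ⟨fun x hx => .inl (.inl hx), fun hsub => hw.1 (hsub (.inl (.inr rfl)))⟩
  stuck p _ hw := if_neg hw

theorem search_spec {H : SimpleGraph (Fin n)} {d : ℕ} {D I : Set (Fin n)}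
    {cl : Fin n → Fin n → Prop} {N : Fin n → Fin n → Fin n} {u v : Fin n}
    (h : IsForest H d D I cl N) (hu : u ∈ D) (hv : v ∈ D) :
    IsSearch D I cl N u v (search cl N u v).1 (search cl N u v).2 ∧
      ∀ w, w ∉ (search cl N u v).1 → N v w ∉ (search cl N u v).1 := by
  obtain ⟨hinv, hmax⟩ := (IsProgress.sweep fun w => isProgress_extendPetal h hu hv w)
    |>.iterate (m := n) (s := ({l | cl u l}, N)) (fun p _ => ncard_fin_le p.1) n
      (h.isSearch_initial hu) (Nat.le_add_left _ _)
  exact ⟨hinv, fun w hw hvw => hmax ⟨w, hw, hvw⟩⟩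

namespace SearchState

variable {H : SimpleGraph (Fin n)} {s : SearchState n} {u v : Fin n}

/-- The invariant of the blossom algorithm. -/
structure IsValid (H : SimpleGraph (Fin n)) (s : SearchState n) : Prop where
  isMatch : IsMatch H s.matching
  forest : IsForest H (fixedPoints s.matching).ncard s.outer s.inner s.blossom s.missing
  fixed_subset : fixedPoints s.matching ⊆ s.outer

theorem isValid_start {f : Fin n → Fin n} (hf : IsMatch H f) : (start f).IsValid H :=
  ⟨hf, isForest_initial hf, subset_rfl⟩

theorem IsValid.grow (hs : s.IsValid H) (hv : v ∈ s.outer) (huv : H.Adj v u) (hu : u ∉ s.outer)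
    (huI : u ∉ s.inner) :
    (s.grow v u).IsValid H ∧ s.outer.ncard < (s.grow v u).outer.ncard := by
  have hr : s.missing v u ∉ s.outer :=
    ((hs.forest.rooted v hv).apply_notMem hs.forest.toIsPartition hu huI).1
  refine ⟨⟨hs.isMatch, hs.forest.grow hv huv hu huI (fun x hx => ?_) (if_pos rfl),
    hs.fixed_subset.trans subset_union_left⟩, ncard_lt_ncard ?_⟩
  · exact if_neg (ne_of_mem_of_not_mem hx hr)
  · exact ⟨subset_union_left, fun hsub => hr (hsub (.inr rfl))⟩

theorem IsValid.shrink (hs : s.IsValid H) (hv : v ∈ s.outer) (hu : u ∈ s.outer) (huv : H.Adj v u)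
    (hcl : ¬ s.blossom v u) (hvS : v ∈ (s.petal v u).1) :
    (s.shrink v u).IsValid H ∧ s.outer.ncard < (s.shrink v u).outer.ncard := by
  have hsearch := (search_spec hs.forest hu hv).1
  obtain ⟨w, hwS, hw⟩ :=
    hsearch.exists_inner hs.forest (fun h => hcl (hs.forest.symm _ _ h)) hu hv hvS
  refine ⟨⟨hs.isMatch, hsearch.shrink hs.forest hu hv huv hvS,
    hs.fixed_subset.trans subset_union_left⟩, ncard_lt_ncard ?_⟩
  exact ⟨subset_union_left, fun hsub => hw (hsub (.inr hwS))⟩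

theorem IsValid.augment (hs : s.IsValid H) (hv : v ∈ s.outer) (hu : u ∈ s.outer) (huv : H.Adj v u)
    (hvS : v ∉ (s.petal v u).1) :
    (s.augment v u).IsValid H ∧
      (fixedPoints (s.augment v u).matching).ncard < (fixedPoints s.matching).ncard := by
  obtain ⟨hsearch, hclosed⟩ := search_spec hs.forest hu hv
  obtain ⟨hmatch, hlt⟩ := hsearch.augment hs.forest hu hv huv hvS hclosed
  exact ⟨isValid_start hmatch, hlt⟩

/-- A measure of the progress of the blossom algorithm: the number of outer vertices, which is at
most `n`, may drop only when the matching grows. -/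
noncomputable def progress (s : SearchState n) : ℕ :=
  (fixedPoints s.matching)ᶜ.ncard * (n + 1) + s.outer.ncard

theorem progress_le (s : SearchState n) : s.progress ≤ (n + 1) * (n + 1) := by
  have := ncard_fin_le (fixedPoints s.matching)ᶜ
  have := ncard_fin_le s.outer
  unfold progress
  nlinarith

theorem progress_lt_of_fixedPoints {t : SearchState n}
    (h : (fixedPoints t.matching).ncard < (fixedPoints s.matching).ncard) :
    s.progress < t.progress := by
  have := ncard_add_ncard_compl (fixedPoints s.matching)
  have := ncard_add_ncard_compl (fixedPoints t.matching)
  have := ncard_fin_le s.outer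
  have : (fixedPoints s.matching)ᶜ.ncard + 1 ≤ (fixedPoints t.matching)ᶜ.ncard := by omega
  unfold progress
  nlinarith

theorem isProgress_advance (H : SimpleGraph (Fin n)) (v u : Fin n) :
    IsProgress (IsValid H)
      (fun s => v ∈ s.outer ∧ H.Adj v u ∧ u ∉ s.inner ∧ ¬ s.blossom v u) progress
      (advance H v u) where
  progress s hs h := by
    obtain ⟨hv, huv, huI, hcl⟩ := id h
    rw [advance, if_pos h]
    split_ifs with hu hvS
    · exact (hs.shrink hv hu huv hcl hvS).imp_right (Nat.add_lt_add_left · _)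
    · exact (hs.augment hv hu huv hvS).imp_right progress_lt_of_fixedPoints
    · exact (hs.grow hv huv hu huI).imp_right (Nat.add_lt_add_left · _)
  stuck s _ h := if_neg h

end SearchState

theorem maxMatching_spec (H : SimpleGraph (Fin n)) : IsMatch H (maxMatching H) ∧
    ∀ g, IsMatch H g → (fixedPoints (maxMatching H)).ncard ≤ (fixedPoints g).ncard := by
  have hid : IsMatch H (id : Fin n → Fin n) := ⟨fun _ => rfl, fun _ h => absurd rfl h⟩
  obtain ⟨hs, hstuck⟩ := (IsProgress.sweep fun v => .sweep fun u =>
    SearchState.isProgress_advance H v u) |>.iterate (fun s _ => s.progress_le)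
      ((n + 1) * (n + 1)) (SearchState.isValid_start hid) (Nat.le_add_left _ _)
  rw [iterate_mul] at hs hstuck
  refine ⟨hs.isMatch, fun g hg => ?_⟩
  rcases eq_empty_or_nonempty (fixedPoints (maxMatching H)) with hempty | hne
  · simp [hempty]
  · exact hs.forest.le_ncard_fixedPoints (hne.mono hs.fixed_subset) (by grind) hg

end Matching

end blossom

namespace Ram.PolyTime

open Function Matching

variable {Γ : ℕ → Type} [Data Γ] {H : ∀ n, Γ n → SimpleGraph (Fin n)} {S : ∀ n, Γ n → Set (Fin n)}
  {u v w : ∀ n, Γ n → Fin n} {f g : ∀ n, Γ n → Fin n → Fin n} {cl : ∀ n, Γ n → Fin n → Fin n → Prop}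
  {N : ∀ n, Γ n → Fin n → Fin n → Fin n} {s : ∀ n, Γ n → SearchState n}
  {p : ∀ n, Γ n → Set (Fin n) × (Fin n → Fin n → Fin n)}

open Classical in
protected theorem mix (hS : PolyTime S) (hu : PolyTime u) (hv : PolyTime v) (hf : PolyTime f)
    (hg : PolyTime g) :
    PolyTime fun n x => mix (S n x) (u n x) (v n x) (f n x) (g n x) :=
  lam <| (last.eq hu.weaken).ite hv.weaken <| (last.eq hv.weaken).ite hu.weaken <|
    (mem last hS.weaken).ite (hf.weaken.app last) <|
      (mem (hg.weaken.app last) hS.weaken).ite last (hg.weaken.app last)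

open Classical in
protected theorem extendPetal (hcl : PolyTime cl) (hN : PolyTime N) (hu : PolyTime u)
    (hv : PolyTime v) (hw : PolyTime w) (hp : PolyTime p) :
    PolyTime fun n x => extendPetal (cl n x) (N n x) (u n x) (v n x) (w n x) (p n x) :=
  ((mem hw hp.fst).not.and (mem ((hN.app hv).app hw) hp.fst)).ite
    (((hp.fst.union hw.singleton).union <| of_mem <|
      (hcl.app ((hN.app hu).app hw)).weaken.app last).prodMk <|
      lam (T := fun n => Fin n → Fin n) <| (last.eq hw.weaken).ite
        (hp.fst.mix hu hv (hN.app hu) (hN.app hv)).weaken (hp.snd.weaken.app last)) hp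

protected theorem search (hcl : PolyTime cl) (hN : PolyTime N) (hu : PolyTime u)
    (hv : PolyTime v) : PolyTime fun n x => search (cl n x) (N n x) (u n x) (v n x) :=
  iterate (.sweep <| .extendPetal hcl.weaken.weaken hN.weaken.weaken hu.weaken.weaken
    hv.weaken.weaken last.weaken last) ((of_mem ((hcl.app hu).weaken.app last)).prodMk hN)

protected theorem start (hf : PolyTime f) : PolyTime fun n x => SearchState.start (f n x) := by
  have hfix : PolyTime fun n x => fixedPoints (f n x) := of_mem <| (hf.weaken.app last).eq last
  exact hf.prodMk <| hfix.prodMk <| (of_mem (.const (p := False))).prodMk <|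
    (lam <| lam <| (last.weaken.eq last).and (mem last.weaken hfix.weaken.weaken)).prodMk <|
      lam hf.weaken

open Classical in
protected theorem grow (hs : PolyTime s) (hv : PolyTime v) (hu : PolyTime u) :
    PolyTime fun n x => (s n x).grow (v n x) (u n x) := by
  have hNv : PolyTime fun n x => (s n x).missing (v n x) := hs.snd.snd.snd.snd.app hv
  have hr := hNv.app hu
  exact hs.fst.prodMk <| (hs.snd.fst.union hr.singleton).prodMk <|
    (hs.snd.snd.fst.union hu.singleton).prodMk <|
    (lam <| lam <| ((hs.snd.snd.snd.fst.weaken.weaken.app last.weaken).app last).or <|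
      (last.weaken.eq hr.weaken.weaken).and (last.eq hr.weaken.weaken)).prodMk <|
    lam <| (last.eq hr.weaken).ite (hu.singleton.mix hu hv hNv hNv).weaken
      (hs.snd.snd.snd.snd.weaken.app last)

protected theorem petal (hs : PolyTime s) (hv : PolyTime v) (hu : PolyTime u) :
    PolyTime fun n x => (s n x).petal (v n x) (u n x) :=
  .search hs.snd.snd.snd.fst hs.snd.snd.snd.snd hu hv

protected theorem shrink (hs : PolyTime s) (hv : PolyTime v) (hu : PolyTime u) :
    PolyTime fun n x => (s n x).shrink (v n x) (u n x) := by
  have hpetal := hs.petal hv hu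
  exact hs.fst.prodMk <| (hs.snd.fst.union hpetal.fst).prodMk <|
    (hs.snd.snd.fst.sdiff hpetal.fst).prodMk <|
    (lam <| lam <| ((hs.snd.snd.snd.fst.weaken.weaken.app last.weaken).app last).or <|
      (mem last.weaken hpetal.fst.weaken.weaken).and
        (mem last hpetal.fst.weaken.weaken)).prodMk hpetal.snd

protected theorem augment (hs : PolyTime s) (hv : PolyTime v) (hu : PolyTime u) :
    PolyTime fun n x => (s n x).augment (v n x) (u n x) :=
  .start <| (hs.petal hv hu).fst.mix hu hv (hs.snd.snd.snd.snd.app hu) (hs.snd.snd.snd.snd.app hv)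

open Classical in
protected theorem advance (hH : PolyTime H) (hv : PolyTime v) (hu : PolyTime u) (hs : PolyTime s) :
    PolyTime fun n x => SearchState.advance (H n x) (v n x) (u n x) (s n x) :=
  ((mem hv hs.snd.fst).and <| ((hH.adj.app hv).app hu).and <| (mem hu hs.snd.snd.fst).not.and
    ((hs.snd.snd.snd.fst.app hv).app hu).not).ite
      ((mem hu hs.snd.fst).ite ((mem hv (hs.petal hv hu).fst).ite (hs.shrink hv hu)
        (hs.augment hv hu)) (hs.grow hv hu)) hs

theorem iterate_succ {Δ : ℕ → Type} [Data Δ] [Storable Δ] {f : ∀ n, Γ n → Δ n → Δ n}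
    {b : ∀ n, Γ n → Δ n} (hf : PolyTime₂ f) (hb : PolyTime b) :
    PolyTime fun n x => (f n x)^[n + 1] (b n x) :=
  iterate hf (hf.comp (PolyTime.id.prodMk hb))

protected theorem maxMatching (hH : PolyTime H) : PolyTime fun n x => maxMatching (H n x) :=
  fst <| iterate_succ (iterate_succ (.sweep <| .sweep <| .advance hH.weaken.weaken.weaken.weaken
    last.weaken.weaken last.weaken last) last) (.start (lam last))

end Ram.PolyTime

open Classical in
/-- The least `i` with `φ i`, or `b` if there is none. -/
noncomputable def pick {n : ℕ} (φ : Fin n → Prop) (b : Fin n) : Fin n :=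
  sweep (fun i r => if φ i then i else r) b

theorem pick_spec {n : ℕ} {φ : Fin n → Prop} (h : ∃ i, φ i) (b b' : Fin n) :
    φ (pick φ b) ∧ pick φ b = pick φ b' := by
  classical
  have hfold (L : List (Fin n)) (hL : ∃ i ∈ L, φ i) :
      φ (L.foldr (fun i r => if φ i then i else r) b) ∧
        L.foldr (fun i r => if φ i then i else r) b =
          L.foldr (fun i r => if φ i then i else r) b' := by
    induction L with
    | nil => simp at hL
    | cons i L ih => grind
  simpa [pick, sweep] using hfold (List.finRange n) (by simpa using h)

open Classical in
theorem Ram.PolyTime.pick {Γ : ℕ → Type} [Data Γ] {φ : ∀ n, Γ n → Fin n → Prop}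
    {b : ∀ n, Γ n → Fin n} (hφ : PolyTime₂ φ) (hb : PolyTime b) :
    PolyTime fun n x => pick (φ n x) (b n x) :=
  foldr (f := fun n x i r => if φ n x i then i else r)
    ((hφ.comp (.prodMk PolyTime.id.fst.fst last)).ite last PolyTime.id.fst.snd) hb

section modulator

open Set Function SimpleGraph Matching

variable {n : ℕ} {G : SimpleGraph (Fin n)}

/-- The unmatched vertex or matched pair that contains `x`, represented by one of its vertices. -/
noncomputable def pairRep (f : Fin n → Fin n) (x : Fin n) : Fin n :=
  pick (fun y => y = x ∨ y = f x) x

theorem pairRep_eq_or (f : Fin n → Fin n) (x : Fin n) : pairRep f x = x ∨ pairRep f x = f x :=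
  (pick_spec (φ := fun y => y = x ∨ y = f x) ⟨x, .inl rfl⟩ x x).1

theorem pairRep_apply {f : Fin n → Fin n} (hf : Involutive f) (x : Fin n) :
    pairRep f (f x) = pairRep f x := by
  have hpair : (fun y => y = f x ∨ y = f (f x)) = fun y => y = x ∨ y = f x := by
    simp only [hf x, or_comm]
  rw [pairRep, hpair]
  exact (pick_spec ⟨x, .inl rfl⟩ (f x) x).2

open Classical in
/-- The greedy colouring by independent sets with at least three vertices, completed by a colouring
of the remaining vertices with a minimum number of independent sets. -/
noncomputable def modulatorColour (G : SimpleGraph (Fin n)) (x : Fin n) : Fin n :=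
  if x ∈ (greedy G).1 then pairRep (maxMatching (coGraph G (greedy G).1)) x else (greedy G).2 x

theorem modulatorColour_ne {x y : Fin n} (hxy : G.Adj x y) :
    modulatorColour G x ≠ modulatorColour G y :=
  (greedy_spec G).1.ne_of_adj (col := modulatorColour G) (maxMatching_spec _).1 (pairRep_eq_or _)
    (fun _ hx => if_pos hx) (fun _ hx => if_neg hx) hxy

theorem ncard_range_modulatorColour_le {M : Set (Fin n)} {k : ℕ}
    (hM : P3K1Free (G.induce Mᶜ)) (hk : (G.induce Mᶜ).Colorable k) :
    (range (modulatorColour G)).ncard ≤ k + M.ncard := by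
  obtain ⟨hgreedy, hK⟩ := greedy_spec G
  obtain ⟨hf, hmax⟩ := maxMatching_spec (coGraph G (greedy G).1)
  exact hgreedy.ncard_range_le hK hf hmax (pairRep_eq_or _) (pairRep_apply hf.invol)
    (fun _ hx => if_pos hx) (fun _ hx => if_neg hx) hM hk

open Ram in
theorem polyTime_modulatorColour :
    PolyTime fun n (G : SimpleGraph (Fin n)) => modulatorColour G := by
  have hgreedy : PolyTime fun n (G : SimpleGraph (Fin n)) => greedy G := PolyTime.id.greedy
  have hf := (PolyTime.id.coGraph hgreedy.fst).maxMatching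
  exact .lam <| (PolyTime.last.mem hgreedy.fst.weaken).ite (PolyTime.pick
    ((PolyTime.last.eq PolyTime.last.weaken).or <| PolyTime.last.eq <|
      hf.weaken.weaken.app PolyTime.last.weaken) .last) (hgreedy.snd.weaken.app .last)

theorem mainTheorem11_general :
    ∃ (A : Ram.Program) (p : Polynomial ℕ), ∀ (n : ℕ) (G : SimpleGraph (Fin n)),
      ∃ (t : ℕ) (s : Ram.State), Ram.Exec A (Ram.graphInput G) t s ∧ t ≤ p.eval n ∧
        ∃ c : G.Coloring ℕ, (∀ v : Fin n, c v = s.colour v) ∧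
          ∀ M : Finset (Fin n), IsModulator (fun _ H => P3K1Free H) G M →
            ((Finset.univ.image c).card : ℕ∞) ≤
              (G.induce (M : Set (Fin n))ᶜ).chromaticNumber + (M.card : ℕ∞) := by
  obtain ⟨A, p, hA⟩ := polyTime_modulatorColour.exists_program
  refine ⟨A, p, fun n G => ?_⟩
  obtain ⟨t, s, hexec, ht, hs⟩ := hA n G
  let c : G.Coloring ℕ := .mk (fun v => modulatorColour G v) fun hxy hc =>
    modulatorColour_ne hxy (Fin.ext hc)
  refine ⟨t, s, hexec, ht, c, fun v => (hs v).symm, fun M hM => ?_⟩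
  obtain ⟨k, hk⟩ := ENat.ne_top_iff_exists.1 <|
    chromaticNumber_ne_top_iff_exists.2 ⟨_, colorable_of_fintype (G.induce (M : Set (Fin n))ᶜ)⟩
  have hcard : (Finset.univ.image c).card = (range (modulatorColour G)).ncard := by
    rw [← ncard_coe_finset, Finset.coe_image, Finset.coe_univ, image_univ,
      ← ncard_image_of_injective _ Fin.val_injective, ← range_comp]
    rfl
  rw [hcard, ← hk, ← ncard_coe_finset M]
  exact_mod_cast ncard_range_modulatorColour_le hM (chromaticNumber_le_iff_colorable.1 hk.ge)

end modulator

theorem mainTheorem11 :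
    ∃ (A : Ram.Program) (p : Polynomial ℕ), ∀ (n : ℕ) (G : SimpleGraph (Fin n)),
      ∃ (t : ℕ) (s : Ram.State), Ram.Exec A (Ram.graphInput G) t s ∧ t ≤ p.eval n ∧
        ∃ c : G.Coloring ℕ, (∀ v : Fin n, c v = s.colour v) ∧
          ∀ M : Finset (Fin n), IsMinimumModulator (fun _ H => P3K1Free H) G M →
            ((Finset.univ.image c).card : ℕ∞) ≤
              (G.induce (M : Set (Fin n))ᶜ).chromaticNumber + (M.card : ℕ∞) := by
  obtain ⟨A, p, hA⟩ := mainTheorem11_general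
  exact ⟨A, p, fun n G => let ⟨t, s, hexec, ht, c, hc, hle⟩ := hA n G
    ⟨t, s, hexec, ht, c, hc, fun M hM => hle M hM.1⟩⟩
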